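/- Let $\Sigma$ be a finite signature consisting of relation symbols and constant symbols, and let $<$ be a binary relation symbol not in $\Sigma$. All structures are finite (with non-empty universe). The Gaifman graph of a $\Sigma$-structure $\mathcal A$ joins two distinct elements if they appear in the same tuple of some relation of $\mathcal A$; a class $\mathcal C$ of $\Sigma$-structures has bounded degree if there is $d\in\mathbb N$ such that the Gaifman graph of every $\mathcal A\in\mathcal C$ has maximal degree at most $d$. A first-order sentence $\varphi$ with equality over $\Sigma\cup\{<\}$ that uses only two variables (which may be requantified) is order-invariant if for every finite $\Sigma$-structure $\mathcal A$ and all strict linear orders $<_1,<_2$ on its universe, $(\mathcal A,<_1)\models\varphi$ iff $(\mathcal A,<_2)\models\varphi$; one then writes $\mathcal A\models\varphi$ if $(\mathcal A,<)\models\varphi$ for every (equivalently, some) strict linear order $<$ on the universe of $\mathcal A$. **Theorem.** Let $\mathcal C$ be a class of finite $\Sigma$-structures of bounded degree. Then order-invariant $\mathrm{FO}^2\subseteq\mathrm{FO}$ on $\mathcal C$: for every $\mathcal P\subseteq\mathcal C$, if there is an order-invariant two-variable first-order sentence $\varphi$ over $\Sigma\cup\{<\}$ with $\mathcal P=\{\mathcal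 A\in\mathcal C:\mathcal A\models\varphi\}$, then there is a first-order sentence $\psi$ over $\Sigma$ with $\mathcal P=\{\mathcal A\in\mathcal C:\mathcal A\models\psi\}$. -/

import Mathlib

universe u v w

namespace TwoVarOrder

open FirstOrder

/-! ### Finite structures, bounded degree -/

/-- Signatures that consist of finitely many relation symbols and constant symbols
(relation symbols of any arity; no function symbols of positive arity). -/
structure IsFiniteSignature (L : FirstOrder.Language.{u, v}) : Prop where
  finite_symbols : Finite L.Symbols
  no_functions : ∀ n : ℕ, IsEmpty (L.Functions (n + 1))

/-- A finite structure over the signature `L`, with non-empty universe. -/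
structure FinStr (L : FirstOrder.Language.{u, v}) where
  Carrier : Type w
  [str : L.Structure Carrier]
  [finite : Finite Carrier]
  [nonempty : Nonempty Carrier]

attribute [instance] FinStr.str FinStr.finite FinStr.nonempty

/-- The Gaifman graph of a structure: two distinct elements are adjacent if they appear in the
same tuple of some relation. -/
def gaifmanGraph (L : FirstOrder.Language.{u, v}) (M : Type w) [L.Structure M] : SimpleGraph M where
  Adj a b := a ≠ b ∧ ∃ (n : ℕ) (R : L.Relations n) (x : Fin n → M),
    FirstOrder.Language.Structure.RelMap R x ∧ a ∈ Set.range x ∧ b ∈ Set.range x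
  symm := ⟨fun _ _ ⟨hne, n, R, x, hR, ha, hb⟩ => ⟨hne.symm, n, R, x, hR, hb, ha⟩⟩
  loopless := ⟨fun _ h => h.1 rfl⟩

/-- The degree of the structure `A`, i.e. the maximal degree of its Gaifman graph, is at most
`d`. -/
def DegreeLE {L : FirstOrder.Language.{u, v}} (A : FinStr.{u, v, w} L) (d : ℕ) : Prop :=
  ∀ a : A.Carrier, ((gaifmanGraph L A.Carrier).neighborSet a).ncard ≤ d

/-- A class of finite structures has bounded degree. -/
def BoundedDegree {L : FirstOrder.Language.{u, v}} (C : Set (FinStr.{u, v, w} L)) : Prop :=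
  ∃ d : ℕ, ∀ A ∈ C, DegreeLE A d

/-! ### Two-variable first-order logic -/

/-- First-order formulas with equality in which only two variables, `0` and `1`, occur. Both may
be quantified again inside the scope of a quantifier over the same variable. The other
connectives and `∃` are the usual abbreviations. -/
inductive Formula2 (L : FirstOrder.Language.{u, v}) : Type (max u v)
  | falsum : Formula2 L
  | equal (t₁ t₂ : L.Term (Fin 2)) : Formula2 L
  | rel {n : ℕ} (R : L.Relations n) (ts : Fin n → L.Term (Fin 2)) : Formula2 L
  | imp (φ ψ : Formula2 L) : Formula2 L
  | all (i : Fin 2) (φ : Formula2 L) : Formula2 L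

namespace Formula2

variable {L : FirstOrder.Language.{u, v}}

/-- The free variables of a two-variable formula. -/
def freeVars : Formula2 L → Finset (Fin 2)
  | falsum => ∅
  | equal t₁ t₂ => t₁.varFinset ∪ t₂.varFinset
  | rel _ ts => Finset.univ.biUnion fun j => (ts j).varFinset
  | imp φ ψ => φ.freeVars ∪ ψ.freeVars
  | all i φ => φ.freeVars.erase i

/-- Truth of a two-variable formula under an assignment of the two variables. -/
def Realize {M : Type w} [L.Structure M] : Formula2 L → (Fin 2 → M) → Prop
  | falsum, _ => False
  | equal t₁ t₂, s => t₁.realize s = t₂.realize s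
  | rel R ts, s => FirstOrder.Language.Structure.RelMap R fun j => (ts j).realize s
  | imp φ ψ, s => φ.Realize s → ψ.Realize s
  | all i φ, s => ∀ a : M, φ.Realize (Function.update s i a)

/-- A sentence is a formula without free variables. -/
def IsSentence (φ : Formula2 L) : Prop := φ.freeVars = ∅

/-- Truth of a sentence in a structure. The assignment is immaterial for a sentence, and one
exists since universes are non-empty. -/
def Models (A : FinStr.{u, v, w} L) (φ : Formula2 L) : Prop :=
  ∀ s : Fin 2 → A.Carrier, φ.Realize s

end Formula2

/-! ### Order-invariance -/

/-- The only relation symbol of the signature `{<}`. -/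
inductive LtRel : ℕ → Type
  | lt : LtRel 2

/-- The signature `{<}` with a single binary relation symbol. -/
def ltLang : FirstOrder.Language.{0, 0} := ⟨fun _ => Empty, LtRel⟩

/-- The interpretation of `<` by the binary relation `r`. -/
@[reducible]
def ltStructure {M : Type w} (r : M → M → Prop) : ltLang.Structure M where
  funMap := fun f => nomatch f
  RelMap := fun {_} R => match R with
    | LtRel.lt => fun x => r (x 0) (x 1)

/-- The expansion `(A, r)` of the structure `A` by an interpretation `r` of the new symbol `<`. -/
@[reducible]
def FinStr.expand {L : FirstOrder.Language.{u, v}} (A : FinStr.{u, v, w} L)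
    (r : A.Carrier → A.Carrier → Prop) : FinStr.{u, v, w} (L.sum ltLang) :=
  letI := ltStructure r
  { Carrier := A.Carrier
    str := FirstOrder.Language.sumStructure L ltLang A.Carrier }

/-- A formula over the signature of `L` together with `<` is order-invariant if, in every finite
structure, its truth does not depend on the strict linear order that interprets `<`. -/
def OrderInvariant {L : FirstOrder.Language.{u, v}} (φ : Formula2 (L.sum ltLang)) : Prop :=
  ∀ (A : FinStr.{u, v, w} L) (r r' : A.Carrier → A.Carrier → Prop),
    IsStrictTotalOrder A.Carrier r → IsStrictTotalOrder A.Carrier r' →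
      (φ.Models (A.expand r) ↔ φ.Models (A.expand r'))

/-! ### Logics and definability -/

/-- A logic over the signature `L`: its sentences, and their truth in finite structures. -/
structure Logic (L : FirstOrder.Language.{u, v}) where
  Sentence : Type (max u v)
  Sat : FinStr.{u, v, w} L → Sentence → Prop

/-- First-order logic. -/
def FO (L : FirstOrder.Language.{u, v}) : Logic.{u, v, w} L where
  Sentence := L.Sentence
  Sat A φ := A.Carrier ⊨ φ

/-- Order-invariant two-variable first-order logic. A sentence holds in a structure if it holds
for every (equivalently, by order-invariance, for some) strict linear order on the universe. -/
def OrderInvFO2 (L : FirstOrder.Language.{u, v}) : Logic.{u, v, w} L where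
  Sentence := {φ : Formula2 (L.sum ltLang) // φ.IsSentence ∧ OrderInvariant.{u, v, w} φ}
  Sat A φ := ∀ r : A.Carrier → A.Carrier → Prop,
    IsStrictTotalOrder A.Carrier r → φ.1.Models (A.expand r)

/-- The property `P` of structures of the class `C` is definable in the logic `K`. -/
def DefinableOn {L : FirstOrder.Language.{u, v}} (C : Set (FinStr.{u, v, w} L)) (K : Logic.{u, v, w} L)
    (P : Set (FinStr.{u, v, w} L)) : Prop :=
  ∃ φ : K.Sentence, P = {A | A ∈ C ∧ K.Sat A φ}

/-- `K ⊆ K'` on the class `C`: each property of structures of `C` that is definable in `K` is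
definable in `K'`. -/
def LogicSubsetOn {L : FirstOrder.Language.{u, v}} (C : Set (FinStr.{u, v, w} L))
    (K K' : Logic.{u, v, w} L) : Prop :=
  ∀ P : Set (FinStr.{u, v, w} L), P ⊆ C → DefinableOn C K P → DefinableOn C K' P

end TwoVarOrder

/-! Two pebbles see only the atomic type (`color`) of a pair and its order. The type of an unlinked
pair of distinct elements is determined by the types of its two members, and links form a subgraph
of the Gaifman graph, so link-neighbourhoods are bounded. Order-invariance leaves the order free, so
it is chosen to make the two-pebble game easy for the duplicator.

Fix `K` slightly above the quantifier rank and `Z` large against `K`. A structure of degree at most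
`d` has boundedly many `K`-neighbourhood types. Elements of rare types, together with the constants,
form a core of bounded size (`exists_frequent`). Each element gets a level in `[-Z, Z]` that changes
by at most one along links. The core sits at level `-Z`; for each frequent type, each ordering of
its neighbourhood and each level `±(Z - l)` with `1 ≤ l ≤ K`, one realization of the neighbourhood
is placed at that level, far from everything placed before; levels fade to `0` around these patches
(`exists_levels`, `exists_layout`). The structure is ordered by level. The part of nonzero level has
size bounded independently of the structure.

Let a second structure contain a copy of this part, closed under links except at levels `±1`, and
let all its elements outside the copy of the core have frequent types. It can be ordered in the same
way (`exists_matched`). With `n` rounds left, the duplicator copies the elements near the extreme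
levels and keeps other elements locally similar; a spoiler move unlinked to the other pebble is
answered by a patch at level `±(Z - (n + 1))`, with the sign that gives the right order
(`Matched.position_step`). So the two ordered structures agree on the sentence, and by
order-invariance so do the structures.

Containing such a copy is first-order expressible (`FODefinable.fits`), and there are only finitely
many templates for it. The required sentence is the disjunction of the templates that force the
given sentence. -/

namespace TwoVarOrder

open FirstOrder FirstOrder.Language

/-! ### Atomic two-variable types -/

section Colors

variable (L : FirstOrder.Language.{u, v})

/-- The terms over two variables in a signature without proper function symbols. -/
abbrev PairTerm := Fin 2 ⊕ L.Constants

/-- Atomic two-variable types: the truth values of all atomic formulas over two variables. -/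
abbrev Color :=
  (PairTerm L → PairTerm L → Prop) ×
    ((R : Σ n, L.Relations n) → (Fin R.1 → PairTerm L) → Prop)

variable {M : Type w} {N : Type w} [L.Structure M] [L.Structure N]

/-- The value of a term at a pair of elements. -/
def pairEval (a b : M) : PairTerm L → M := Sum.elim ![a, b] fun c => (c : M)

/-- The atomic two-variable type of a pair of elements. -/
def color (a b : M) : Color L :=
  (fun i j => pairEval L a b i = pairEval L a b j,
    fun R ts => Structure.RelMap R.2 (pairEval L a b ∘ ts))

/-- The two variables denote distinct elements and occur together in a relational atom. -/
def Color.IsLink {L : FirstOrder.Language.{u, v}} (c : Color L) : Prop :=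
  ¬ c.1 (Sum.inl 0) (Sum.inl 1) ∧
    ∃ R ts, c.2 R ts ∧ Sum.inl 0 ∈ Set.range ts ∧ Sum.inl 1 ∈ Set.range ts

/-- Two distinct elements that occur together in a tuple of a relation whose other entries are
among these two elements and the constants. -/
def Linked (a b : M) : Prop := (color L a b).IsLink

variable {L}

@[simp] theorem pairEval_zero (a b : M) : pairEval L a b (Sum.inl 0) = a := rfl
@[simp] theorem pairEval_one (a b : M) : pairEval L a b (Sum.inl 1) = b := rfl
@[simp] theorem pairEval_const (a b : M) (c : L.Constants) :
    pairEval L a b (Sum.inr c) = (c : M) := rfl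

theorem finite_relations (hL : IsFiniteSignature L) : Finite (Σ n, L.Relations n) := by
  have h := hL.finite_symbols
  exact Finite.of_injective (fun x => (Sum.inr x : L.Symbols)) Sum.inr_injective

theorem finite_constants (hL : IsFiniteSignature L) : Finite L.Constants := by
  have h := hL.finite_symbols
  exact Finite.of_injective (fun c => (Sum.inl ⟨0, c⟩ : L.Symbols)) fun a b hab => by
    simpa using hab

theorem finite_color (hL : IsFiniteSignature L) : Finite (Color L) := by
  have := finite_relations hL
  have := finite_constants hL
  infer_instance

theorem pairEval_map (a b : M) (g : Fin 2 → Fin 2) (i : PairTerm L) :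
    pairEval L (![a, b] (g 0)) (![a, b] (g 1)) i = pairEval L a b (Sum.map g id i) := by
  rcases i with i | c
  · fin_cases i <;> rfl
  · rfl

/-- Substituting variables for variables keeps formulas atomic, so the type of a pair determines the
type of every pair formed from its entries. -/
theorem color_map {a b : M} {a' b' : N} (h : color L a b = color L a' b') (g : Fin 2 → Fin 2) :
    color L (![a, b] (g 0)) (![a, b] (g 1)) = color L (![a', b'] (g 0)) (![a', b'] (g 1)) := by
  have h1 := congrArg Prod.fst h
  have h2 := congrArg Prod.snd h
  refine Prod.ext ?_ ?_
  · funext i j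
    have := congrFun (congrFun h1 (Sum.map g id i)) (Sum.map g id j)
    simpa only [color, pairEval_map] using this
  · funext R ts
    have := congrFun (congrFun h2 R) (Sum.map g id ∘ ts)
    simpa only [color, Function.comp_def, pairEval_map] using this

theorem color_swap {a b : M} {a' b' : N} (h : color L a b = color L a' b') :
    color L b a = color L b' a' := color_map h ![1, 0]

theorem pairEval_eq_iff {a b : M} {a' b' : N} (h : color L a b = color L a' b')
    (i j : PairTerm L) :
    pairEval L a b i = pairEval L a b j ↔ pairEval L a' b' i = pairEval L a' b' j :=
  iff_of_eq (congrFun (congrFun (congrArg Prod.fst h) i) j)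

theorem relMap_pairEval_iff {a b : M} {a' b' : N} (h : color L a b = color L a' b')
    {n : ℕ} (R : L.Relations n) (ts : Fin n → PairTerm L) :
    Structure.RelMap R (fun k => pairEval L a b (ts k)) ↔
      Structure.RelMap R (fun k => pairEval L a' b' (ts k)) :=
  iff_of_eq (congrFun (congrFun (congrArg Prod.snd h) ⟨n, R⟩) ts)

theorem eq_iff_of_color {a b : M} {a' b' : N} (h : color L a b = color L a' b') :
    a = b ↔ a' = b' := pairEval_eq_iff h (Sum.inl 0) (Sum.inl 1)

theorem eq_const_iff_of_color {a b : M} {a' b' : N} (h : color L a b = color L a' b')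
    (c : L.Constants) : a = (c : M) ↔ a' = (c : N) := pairEval_eq_iff h (Sum.inl 0) (Sum.inr c)

theorem linked_iff_of_color {a b : M} {a' b' : N} (h : color L a b = color L a' b') :
    Linked L a b ↔ Linked L a' b' := by rw [Linked, Linked, h]

theorem linked_iff {a b : M} : Linked L a b ↔ a ≠ b ∧ ∃ (n : ℕ) (R : L.Relations n)
    (ts : Fin n → PairTerm L), Structure.RelMap R (fun k => pairEval L a b (ts k)) ∧
      (∃ k, ts k = Sum.inl 0) ∧ ∃ k, ts k = Sum.inl 1 := by
  refine and_congr Iff.rfl ⟨?_, ?_⟩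
  · rintro ⟨⟨n, R⟩, ts, h⟩
    exact ⟨n, R, ts, h⟩
  · rintro ⟨n, R, ts, h⟩
    exact ⟨⟨n, R⟩, ts, h⟩

theorem Linked.symm {a b : M} (h : Linked L a b) : Linked L b a := by
  obtain ⟨hne, n, R, ts, hR, ⟨k, hk⟩, l, hl⟩ := linked_iff.1 h
  refine linked_iff.2 ⟨hne.symm, n, R, fun k => Sum.map ![1, 0] id (ts k), ?_,
    ⟨l, by simp [hl]⟩, k, by simp [hk]⟩
  have := fun i => pairEval_map (L := L) b a ![1, 0] i
  simp only [← this]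
  exact hR

/-- This transfers the degree bound to links. The converse fails: a Gaifman edge may come only from
tuples with a third, non-constant entry, which two variables cannot express by an atom. -/
theorem Linked.gaifman {a b : M} (h : Linked L a b) : (gaifmanGraph L M).Adj a b := by
  obtain ⟨hne, n, R, ts, hR, ⟨k, hk⟩, l, hl⟩ := linked_iff.1 h
  exact ⟨hne, n, R, _, hR, ⟨k, by simp [hk]⟩, l, by simp [hl]⟩

theorem pairEval_diag_left {a b : M} {i : PairTerm L} (h : i ≠ Sum.inl 1) :
    pairEval L a b i = pairEval L a a i := by
  rcases i with i | c
  · fin_cases i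
    · rfl
    · exact absurd rfl h
  · rfl

theorem pairEval_diag_right {a b : M} {i : PairTerm L} (h : i ≠ Sum.inl 0) :
    pairEval L a b i = pairEval L b b i := by
  rcases i with i | c
  · fin_cases i
    · exact absurd rfl h
    · rfl
  · rfl

/-- The atomic type of an unlinked pair of distinct elements is determined by the types of the
two elements. -/
theorem color_eq_of_not_linked {a b : M} {a' b' : N} (hab : a ≠ b) (hab' : a' ≠ b')
    (hl : ¬ Linked L a b) (hl' : ¬ Linked L a' b') (ha : color L a a = color L a' a')
    (hb : color L b b = color L b' b') : color L a b = color L a' b' := by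
  rw [linked_iff] at hl hl'
  push Not at hl hl'
  refine Prod.ext ?_ ?_
  · funext i j
    refine propext (show pairEval L a b i = pairEval L a b j ↔
      pairEval L a' b' i = pairEval L a' b' j from ?_)
    by_cases hi : i = Sum.inl 1
    · by_cases hj : j = Sum.inl 0
      · subst hi hj
        simp [hab.symm, hab'.symm]
      · have hi0 : i ≠ Sum.inl 0 := by simp [hi]
        rw [pairEval_diag_right (a := a) hi0, pairEval_diag_right (a := a') hi0,
          pairEval_diag_right (a := a) hj, pairEval_diag_right (a := a') hj]
        exact pairEval_eq_iff hb i j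
    · by_cases hj : j = Sum.inl 1
      · by_cases hi0 : i = Sum.inl 0
        · subst hi0 hj
          simp [hab, hab']
        · have hj0 : j ≠ Sum.inl 0 := by simp [hj]
          rw [pairEval_diag_right (a := a) hi0, pairEval_diag_right (a := a') hi0,
            pairEval_diag_right (a := a) hj0, pairEval_diag_right (a := a') hj0]
          exact pairEval_eq_iff hb i j
      · rw [pairEval_diag_left (b := b) hi, pairEval_diag_left (b := b') hi,
          pairEval_diag_left (b := b) hj, pairEval_diag_left (b := b') hj]
        exact pairEval_eq_iff ha i j
  · funext ⟨n, R⟩ ts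
    refine propext (show Structure.RelMap R (fun k => pairEval L a b (ts k)) ↔
      Structure.RelMap R (fun k => pairEval L a' b' (ts k)) from ?_)
    by_cases h1 : ∃ k, ts k = Sum.inl 1
    · by_cases h0 : ∃ k, ts k = Sum.inl 0
      · obtain ⟨k1, h1⟩ := h1
        exact iff_of_false (fun h => hl hab n R ts h h0 k1 h1)
          (fun h => hl' hab' n R ts h h0 k1 h1)
      · push Not at h0
        simp only [fun k => pairEval_diag_right (a := a) (b := b) (h0 k),
          fun k => pairEval_diag_right (a := a') (b := b') (h0 k)]
        exact relMap_pairEval_iff hb R ts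
    · push Not at h1
      simp only [fun k => pairEval_diag_left (a := a) (b := b) (h1 k),
        fun k => pairEval_diag_left (a := a') (b := b') (h1 k)]
      exact relMap_pairEval_iff ha R ts

end Colors

/-! ### Back-and-forth systems for two-variable logic -/

namespace Formula2

/-- The quantifier rank. -/
def rank {L : FirstOrder.Language.{u, v}} : Formula2 L → ℕ
  | falsum => 0
  | equal _ _ => 0
  | rel _ _ => 0
  | imp φ ψ => max φ.rank ψ.rank
  | all _ φ => φ.rank + 1

theorem realize_iff_of_backAndForth {L : FirstOrder.Language.{u, v}} {M N : Type w}
    [L.Structure M] [L.Structure N] (W : ℕ → (Fin 2 → M) → (Fin 2 → N) → Prop) (k : ℕ)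
    (heq : ∀ n s s', W n s s' → ∀ t₁ t₂ : L.Term (Fin 2),
      t₁.realize s = t₂.realize s ↔ t₁.realize s' = t₂.realize s')
    (hrel : ∀ n s s', W n s s' → ∀ (m : ℕ) (R : L.Relations m) (ts : Fin m → L.Term (Fin 2)),
      Structure.RelMap R (fun j => (ts j).realize s) ↔
        Structure.RelMap R (fun j => (ts j).realize s'))
    (forth : ∀ n < k, ∀ s s', W (n + 1) s s' → ∀ i a,
      ∃ b, W n (Function.update s i a) (Function.update s' i b))
    (back : ∀ n < k, ∀ s s', W (n + 1) s s' → ∀ i b,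
      ∃ a, W n (Function.update s i a) (Function.update s' i b))
    (φ : Formula2 L) : ∀ n ≤ k, φ.rank ≤ n → ∀ s s', W n s s' → (φ.Realize s ↔ φ.Realize s') := by
  induction φ with
  | falsum => intros; rfl
  | equal t₁ t₂ => exact fun n _ _ s s' h => heq n s s' h t₁ t₂
  | rel R ts => exact fun n _ _ s s' h => hrel n s s' h _ R ts
  | imp φ ψ ihφ ihψ =>
    intro n hk hn s s' h
    exact imp_congr (ihφ n hk ((le_max_left _ _).trans hn) s s' h)
      (ihψ n hk ((le_max_right _ _).trans hn) s s' h)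
  | all i φ ih =>
    intro n hk hn s s' h
    obtain ⟨n, rfl⟩ : ∃ n', n = n' + 1 := ⟨n - 1, by simp only [rank] at hn; omega⟩
    have hn' : φ.rank ≤ n := by simp only [rank] at hn; omega
    constructor
    · intro hs b
      obtain ⟨a, ha⟩ := back n (by omega) s s' h i b
      exact (ih n (by omega) hn' _ _ ha).1 (hs a)
    · intro hs a
      obtain ⟨b, hb⟩ := forth n (by omega) s s' h i a
      exact (ih n (by omega) hn' _ _ hb).2 (hs b)

end Formula2

/-! ### Local similarity of ordered structures -/

section Game

variable {L : FirstOrder.Language.{u, v}} {M N : Type w} [L.Structure M] [L.Structure N]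

variable (L) in
/-- The elements linked to `u i` are listed by `u`, as long as the fuel `h i` is positive; the
fuel drops by at most one along a link. -/
def Insulated {ι : Type*} (u : ι → M) (h : ι → ℕ) : Prop :=
  ∀ i, 1 ≤ h i → ∀ y, Linked L (u i) y → ∃ j, u j = y ∧ h i ≤ h j + 1

variable (L) in
/-- `a` and `b` correspond in isomorphic ordered substructures that contain all elements within
link-distance `n` from them. -/
def LocalSim (r : M → M → Prop) (r' : N → N → Prop) (n : ℕ) (a : M) (b : N) : Prop :=
  ∃ (m : ℕ) (u : Fin m → M) (v : Fin m → N) (h : Fin m → ℕ) (i : Fin m),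
    u i = a ∧ v i = b ∧ n ≤ h i ∧ Insulated L u h ∧ Insulated L v h ∧
      ∀ i j, color L (u i) (u j) = color L (v i) (v j) ∧ (r (u i) (u j) ↔ r' (v i) (v j))

namespace LocalSim

variable {r : M → M → Prop} {r' : N → N → Prop} {n : ℕ} {a : M} {b : N}

theorem symm (h : LocalSim L r r' n a b) : LocalSim L r' r n b a := by
  obtain ⟨m, u, v, h, i, hu, hv, hn, hiu, hiv, hc⟩ := h
  exact ⟨m, v, u, h, i, hv, hu, hn, hiv, hiu, fun i j => ⟨(hc i j).1.symm, (hc i j).2.symm⟩⟩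

theorem mono {k : ℕ} (hk : k ≤ n) (h : LocalSim L r r' n a b) : LocalSim L r r' k a b := by
  obtain ⟨m, u, v, h, i, hu, hv, hn, hc⟩ := h
  exact ⟨m, u, v, h, i, hu, hv, hk.trans hn, hc⟩

theorem color_eq (h : LocalSim L r r' n a b) : color L a a = color L b b := by
  obtain ⟨m, u, v, h, i, rfl, rfl, hn, hiu, hiv, hc⟩ := h
  exact (hc i i).1

/-- Following a link costs one unit of fuel inside the same witnessing substructures, hence one unit
of radius. -/
theorem linked (h : LocalSim L r r' (n + 1) a b) {a' : M} (ha : Linked L a a') :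
    ∃ b', LocalSim L r r' n a' b' ∧ color L a a' = color L b b' ∧ (r a a' ↔ r' b b') := by
  obtain ⟨m, u, v, h, i, rfl, rfl, hn, hiu, hiv, hc⟩ := h
  obtain ⟨j, rfl, hj⟩ := hiu i (by omega) a' ha
  exact ⟨v j, ⟨m, u, v, h, j, rfl, rfl, by omega, hiu, hiv, hc⟩, hc i j⟩

end LocalSim

/-! ### Matched layouts -/

variable (L) in
/-- Two ordered structures with level functions `z` and `z'` share the finite part `t`, `t'` on
which the levels are nonzero, and each local situation of the first structure outside of the
extreme level `-Z` occurs in the second structure at all levels at distance at most `K` from the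
extreme levels `Z` and `-Z`. -/
structure Matched (Z K : ℕ) {k : ℕ} (z : M → ℤ) (r : M → M → Prop) (t : Fin k → M)
    (z' : N → ℤ) (r' : N → N → Prop) (t' : Fin k → N) : Prop where
  color_eq : ∀ i j, color L (t i) (t j) = color L (t' i) (t' j)
  lt_iff : ∀ i j, r (t i) (t j) ↔ r' (t' i) (t' j)
  level_eq : ∀ i, z (t i) = z' (t' i)
  cover : ∀ x, z x ≠ 0 → ∃ i, t i = x
  lipschitz : ∀ x y, Linked L x y → (z x - z y).natAbs ≤ 1
  lt_of_level_lt : ∀ x y, z x < z y → r x y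
  asymm : ∀ x y, r x y → ¬ r y x
  total : ∀ x y, x ≠ y → r x y ∨ r y x
  level_const : ∀ c : L.Constants, z (c : M) = -Z
  rich : ∀ x, z x ≠ -Z → ∀ l : ℕ, 1 ≤ l → l ≤ K → ∀ s : ℤ, s = 1 ∨ s = -1 →
    ∃ y, z' y = s * (Z - l) ∧ (∀ y', Linked L y y' → z' y' = z' y) ∧ LocalSim L r r' K x y

variable (L) in
/-- The positions from which the duplicator survives `n` more rounds. -/
def Position (Z : ℕ) {k : ℕ} (z : M → ℤ) (r : M → M → Prop) (t : Fin k → M)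
    (z' : N → ℤ) (r' : N → N → Prop) (t' : Fin k → N) (n : ℕ) (a : M) (b : N) : Prop :=
  (∃ i, t i = a ∧ t' i = b ∧ Z ≤ (z a).natAbs + n) ∨
    ((z a).natAbs + n < Z ∧ (z' b).natAbs + n < Z ∧ LocalSim L r r' n a b)

namespace Matched

variable {Z K k : ℕ} {z : M → ℤ} {r : M → M → Prop} {t : Fin k → M} {z' : N → ℤ}
  {r' : N → N → Prop} {t' : Fin k → N}

/-- Levels change by at most one along links, so a neighbour of an element at absolute level at
least `2` has nonzero level and is listed by `t`. The shared part is thus itself a witness for local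
similarity, with the absolute level minus one as fuel. -/
theorem insulated (H : Matched L Z K z r t z' r' t') :
    Insulated L t fun i => (z (t i)).natAbs - 1 := by
  intro i hi y hy
  have h1 := H.lipschitz _ _ hy
  dsimp only at hi
  obtain ⟨j, rfl⟩ := H.cover y (by omega)
  exact ⟨j, rfl, by dsimp only; omega⟩

theorem localSim (H : Matched L Z K z r t z' r' t') (H' : Matched L Z K z' r' t' z r t)
    {n : ℕ} {i : Fin k} (hi : n + 1 ≤ (z (t i)).natAbs) : LocalSim L r r' n (t i) (t' i) := by
  have h1 := H'.insulated
  simp only [← H.level_eq] at h1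
  exact ⟨k, t, t', _, i, rfl, rfl, by omega, H.insulated, h1,
    fun i j => ⟨H.color_eq i j, H.lt_iff i j⟩⟩

theorem position_symm (H : Matched L Z K z r t z' r' t') {n : ℕ} {a : M} {b : N}
    (h : Position L Z z r t z' r' t' n a b) : Position L Z z' r' t' z r t n b a := by
  rcases h with ⟨i, rfl, rfl, hi⟩ | ⟨ha, hb, h⟩
  · exact Or.inl ⟨i, rfl, rfl, by rwa [← H.level_eq]⟩
  · exact Or.inr ⟨hb, ha, h.symm⟩

/-- An element of the shared part at level at least `n + 1` is in position with its copy. -/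
theorem position_copy (H : Matched L Z K z r t z' r' t') (H' : Matched L Z K z' r' t' z r t)
    {n : ℕ} {i : Fin k} (hi : n + 1 ≤ (z (t i)).natAbs) :
    Position L Z z r t z' r' t' n (t i) (t' i) := by
  by_cases h : Z ≤ (z (t i)).natAbs + n
  · exact Or.inl ⟨i, rfl, rfl, h⟩
  · exact Or.inr ⟨by omega, by rw [← H.level_eq]; omega, H.localSim H' hi⟩

/-- The zone in which pebbles must be exact copies shrinks as rounds pass. A pair that drops out of
it is still locally similar, since its level is high. -/
theorem position_mono (H : Matched L Z K z r t z' r' t') (H' : Matched L Z K z' r' t' z r t)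
    {n : ℕ} (hn : n < K) (hZ : 2 * K + 3 ≤ Z) {a : M} {b : N}
    (h : Position L Z z r t z' r' t' (n + 1) a b) : Position L Z z r t z' r' t' n a b := by
  rcases h with ⟨i, rfl, rfl, hi⟩ | ⟨ha, hb, h⟩
  · exact H.position_copy H' (by omega)
  · exact Or.inr ⟨by omega, by omega, h.mono (by omega)⟩

theorem position_color (H : Matched L Z K z r t z' r' t') {n : ℕ} {a : M} {b : N}
    (h : Position L Z z r t z' r' t' n a b) : color L a a = color L b b := by
  rcases h with ⟨i, rfl, rfl, hi⟩ | ⟨ha, hb, h⟩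
  · exact H.color_eq i i
  · exact h.color_eq

theorem lt_swap (H : Matched L Z K z r t z' r' t') (H' : Matched L Z K z' r' t' z r t)
    {a a' : M} {b b' : N} (hc : color L a a' = color L b b') (h : r a a' ↔ r' b b') :
    r a' a ↔ r' b' b := by
  have he := eq_iff_of_color hc
  by_cases hab : a = a'
  · obtain rfl := he.1 hab
    subst hab
    exact h
  · have hab' : b ≠ b' := fun h => hab (he.2 h)
    have h1 := H.total _ _ hab
    have h2 := H'.total _ _ hab'
    have h3 := H.asymm a a'
    have h4 := H'.asymm b b'
    tauto

/-- Constants lie at the bottom level `-Z`: they belong to the shared part and precede every element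
that is not in the copied zone. -/
theorem position_const (H : Matched L Z K z r t z' r' t') (H' : Matched L Z K z' r' t' z r t)
    (hZ : 1 ≤ Z) {n : ℕ} {a : M} {b : N} (h : Position L Z z r t z' r' t' n a b)
    (c : L.Constants) : (r a (c : M) ↔ r' b (c : N)) ∧ (r (c : M) a ↔ r' (c : N) b) := by
  have hc := H.level_const c
  have hc' := H'.level_const c
  rcases h with ⟨i, rfl, rfl, hi⟩ | ⟨ha, hb, h⟩
  · obtain ⟨j, hj⟩ := H.cover (c : M) (by omega)
    have hj' : t' j = (c : N) := (eq_const_iff_of_color (H.color_eq j j) c).1 hj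
    rw [← hj, ← hj']
    exact ⟨H.lt_iff _ _, H.lt_iff _ _⟩
  · have h1 := H.lt_of_level_lt (c : M) a (by omega)
    have h2 := H'.lt_of_level_lt (c : N) b (by omega)
    exact ⟨iff_of_false (H.asymm _ _ h1) (H'.asymm _ _ h2), iff_of_true h1 h2⟩

theorem exists_position (H : Matched L Z K z r t z' r' t') (H' : Matched L Z K z' r' t' z r t)
    {n : ℕ} (hn : n < K) (hZ : 2 * K + 3 ≤ Z) (a : M) :
    ∃ b, Position L Z z r t z' r' t' n a b := by
  by_cases h : n + 1 ≤ (z a).natAbs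
  · obtain ⟨i, rfl⟩ := H.cover a (by omega)
    exact ⟨_, H.position_copy H' h⟩
  · obtain ⟨b, hb, -, hsim⟩ :=
      H.rich a (by omega) (n + 1) (by omega) (by omega) 1 (Or.inl rfl)
    exact ⟨b, Or.inr ⟨by omega, by omega, hsim.mono (by omega)⟩⟩

/-- One round of the game. -/
theorem position_step (H : Matched L Z K z r t z' r' t') (H' : Matched L Z K z' r' t' z r t)
    {n : ℕ} (hn : n < K) (hZ : 2 * K + 3 ≤ Z) {a : M} {b : N}
    (h : Position L Z z r t z' r' t' (n + 1) a b) (a' : M) :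
    ∃ b', Position L Z z r t z' r' t' n a' b' ∧ color L a a' = color L b b' ∧
      (r a a' ↔ r' b b') := by
  have hcab := H.position_color h
  have hne : ∀ {x y : M}, z x ≠ z y → x ≠ y := fun hz h => hz (by rw [h])
  have hne' : ∀ {x y : N}, z' x ≠ z' y → x ≠ y := fun hz h => hz (by rw [h])
  have hrich := fun hx s hs => H.rich a' hx (n + 1) (by omega) (by omega) s hs
  push_cast at hrich
  rcases h with ⟨i, rfl, rfl, hi⟩ | ⟨ha, hb, h⟩
  · have hzi := H.level_eq i
    -- The threshold is `n + 2` rather than `n + 1`: below it, the levels of `a'` and `t i` differ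
    -- by at least two, so the pair is not linked.
    by_cases ha' : Z ≤ (z a').natAbs + (n + 2)
    · obtain ⟨j, rfl⟩ := H.cover a' (by omega)
      exact ⟨t' j, H.position_copy H' (by omega), H.color_eq i j, H.lt_iff i j⟩
    · push Not at ha'
      -- The reply lies on the side opposite to `t i`. On the same side its level could coincide
      -- with that of the copy `t' i`; on the opposite side it is unlinked to `t' i` and correctly
      -- ordered.
      have key : ∀ s : ℤ, (s = 1 ∨ s = -1) → s * z (t i) ≤ 0 →
          ∃ b', Position L Z z r t z' r' t' n a' b' ∧ color L (t i) a' = color L (t' i) b' ∧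
            z' b' = s * (Z - (n + 1)) := by
        intro s hs hsz
        obtain ⟨b', hb', hl, hsim⟩ := hrich (by omega) s hs
        have hd : 2 ≤ (z' (t' i) - z' b').natAbs := by
          rw [hb', ← hzi]
          rcases hs with rfl | rfl <;> omega
        refine ⟨b', Or.inr ⟨by omega, ?_, hsim.mono (by omega)⟩, ?_, hb'⟩
        · rw [hb']
          rcases hs with rfl | rfl <;> omega
        · refine color_eq_of_not_linked (hne (by omega)) (hne' (by omega)) ?_ ?_ hcab
            hsim.color_eq
          · intro hl
            have := H.lipschitz _ _ hl
            omega
          · intro hl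
            have := H'.lipschitz _ _ hl
            omega
      rcases le_total 0 (z (t i)) with h0 | h0
      · obtain ⟨b', hp, hcol, hb'⟩ := key (-1) (Or.inr rfl) (by omega)
        refine ⟨b', hp, hcol, iff_of_false ?_ ?_⟩
        · exact H.asymm _ _ (H.lt_of_level_lt _ _ (by omega))
        · exact H'.asymm _ _ (H'.lt_of_level_lt _ _ (by omega))
      · obtain ⟨b', hp, hcol, hb'⟩ := key 1 (Or.inl rfl) (by omega)
        refine ⟨b', hp, hcol, iff_of_true ?_ ?_⟩
        · exact H.lt_of_level_lt _ _ (by omega)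
        · exact H'.lt_of_level_lt _ _ (by omega)
  · by_cases ha' : Z ≤ (z a').natAbs + n
    · obtain ⟨j, rfl⟩ := H.cover a' (by omega)
      have hzj := H.level_eq j
      refine ⟨t' j, H.position_copy H' (by omega), ?_, ?_⟩
      · refine color_eq_of_not_linked (hne (by omega)) (hne' (by omega)) ?_ ?_ hcab
          (H.color_eq j j)
        · intro hl
          have := H.lipschitz _ _ hl
          omega
        · intro hl
          have := H'.lipschitz _ _ hl
          omega
      · rcases le_total 0 (z (t j)) with h0 | h0
        · exact iff_of_true (H.lt_of_level_lt _ _ (by omega)) (H'.lt_of_level_lt _ _ (by omega))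
        · exact iff_of_false (H.asymm _ _ (H.lt_of_level_lt _ _ (by omega)))
            (H'.asymm _ _ (H'.lt_of_level_lt _ _ (by omega)))
    · push Not at ha'
      by_cases hl : Linked L a a'
      · obtain ⟨b', hsim, hcol, hlt⟩ := h.linked hl
        have := H'.lipschitz _ _ ((linked_iff_of_color hcol).1 hl)
        exact ⟨b', Or.inr ⟨by omega, by omega, hsim⟩, hcol, hlt⟩
      by_cases heq : a = a'
      · subst heq
        refine ⟨b, Or.inr ⟨by omega, by omega, h.mono (by omega)⟩, hcab, ?_⟩
        exact iff_of_false (fun h => H.asymm _ _ h h) (fun h => H'.asymm _ _ h h)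
      -- The level `Z - (n + 1)` strictly exceeds `|z' b|`, but is still allowed with `n` rounds
      -- left. All neighbours of `b'` share its level, so `b` is not among them, and the free sign
      -- `s` realizes either order.
      have key : ∀ s : ℤ, (s = 1 ∨ s = -1) →
          ∃ b', Position L Z z r t z' r' t' n a' b' ∧ color L a a' = color L b b' ∧
            z' b' = s * (Z - (n + 1)) := by
        intro s hs
        obtain ⟨b', hb', hl', hsim⟩ := hrich (by omega) s hs
        have hd : z' b ≠ z' b' := by
          rw [hb']
          rcases hs with rfl | rfl <;> omega
        refine ⟨b', Or.inr ⟨ha', ?_, hsim.mono (by omega)⟩, ?_, hb'⟩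
        · rw [hb']
          rcases hs with rfl | rfl <;> omega
        · refine color_eq_of_not_linked heq (hne' hd) hl ?_ hcab hsim.color_eq
          exact fun hl => hd (hl' _ hl.symm)
      rcases H.total _ _ heq with hlt | hlt
      · obtain ⟨b', hp, hcol, hb'⟩ := key 1 (Or.inl rfl)
        exact ⟨b', hp, hcol, iff_of_true hlt (H'.lt_of_level_lt _ _ (by omega))⟩
      · obtain ⟨b', hp, hcol, hb'⟩ := key (-1) (Or.inr rfl)
        exact ⟨b', hp, hcol, iff_of_false (H.asymm _ _ hlt)
          (H'.asymm _ _ (H'.lt_of_level_lt _ _ (by omega)))⟩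

end Matched

end Game

/-! ### Matched layouts satisfy the same two-variable sentences -/

section Transfer

variable {L : FirstOrder.Language.{u, v}}

theorem exists_pairTerm (hL : IsFiniteSignature L) (t : (L.sum ltLang).Term (Fin 2)) :
    ∃ i : PairTerm L, ∀ (A : FinStr.{u, v, w} L) (r : A.Carrier → A.Carrier → Prop)
      (s : Fin 2 → (A.expand r).Carrier),
      t.realize s = pairEval (M := A.Carrier) L (s 0) (s 1) i := by
  cases t with
  | var k =>
    refine ⟨Sum.inl k, fun A r s => ?_⟩
    fin_cases k <;> rfl
  | @func n f ts =>
    rcases f with f | f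
    · cases n with
      | zero =>
        refine ⟨Sum.inr f, fun A r s => ?_⟩
        exact congrArg (Structure.funMap (M := A.Carrier) f) (Subsingleton.elim _ _)
      | succ n => exact ((hL.no_functions n).false f).elim
    · exact nomatch f

/-- The reply is made relative to the pebble that is not moved; that pebble keeps its partner with
one round fewer. -/
theorem Matched.forth {M N : Type w} [L.Structure M] [L.Structure N] {Z K k : ℕ} {z : M → ℤ}
    {r : M → M → Prop} {t : Fin k → M} {z' : N → ℤ} {r' : N → N → Prop} {t' : Fin k → N}
    (H : Matched L Z K z r t z' r' t') (H' : Matched L Z K z' r' t' z r t) {n : ℕ} (hn : n < K)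
    (hZ : 2 * K + 3 ≤ Z) {s : Fin 2 → M} {s' : Fin 2 → N}
    (h : ∀ i, Position L Z z r t z' r' t' (n + 1) (s i) (s' i)) (i : Fin 2) (a : M) :
    ∃ b, Position L Z z r t z' r' t' n a b ∧
      (∀ j, Position L Z z r t z' r' t' n (Function.update s i a j) (Function.update s' i b j)) ∧
      color L (Function.update s i a 0) (Function.update s i a 1) =
        color L (Function.update s' i b 0) (Function.update s' i b 1) ∧
      (r (Function.update s i a 0) (Function.update s i a 1) ↔
        r' (Function.update s' i b 0) (Function.update s' i b 1)) := by
  have hm := fun j => H.position_mono H' hn hZ (h j)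
  fin_cases i
  · obtain ⟨b, hb, hc, hr⟩ := H.position_step H' hn hZ (h 1) a
    refine ⟨b, hb, fun j => ?_, ?_, ?_⟩
    · fin_cases j
      · exact hb
      · exact hm 1
    · exact color_swap hc
    · exact H.lt_swap H' hc hr
  · obtain ⟨b, hb, hc, hr⟩ := H.position_step H' hn hZ (h 0) a
    refine ⟨b, hb, fun j => ?_, hc, hr⟩
    fin_cases j
    · exact hm 0
    · exact hb

theorem Matched.pairEval_lt_iff {M N : Type w} [L.Structure M] [L.Structure N] {Z K k : ℕ}
    {z : M → ℤ} {r : M → M → Prop} {t : Fin k → M} {z' : N → ℤ} {r' : N → N → Prop}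
    {t' : Fin k → N} (H : Matched L Z K z r t z' r' t') (H' : Matched L Z K z' r' t' z r t)
    (hZ : 1 ≤ Z) {n : ℕ} {a b : M} {a' b' : N} (ha : Position L Z z r t z' r' t' n a a')
    (hb : Position L Z z r t z' r' t' n b b') (hc : color L a b = color L a' b')
    (hr : r a b ↔ r' a' b') (i j : PairTerm L) :
    r (pairEval L a b i) (pairEval L a b j) ↔ r' (pairEval L a' b' i) (pairEval L a' b' j) := by
  have irr : ∀ x, ¬ r x x := fun x h => H.asymm _ _ h h
  have irr' : ∀ x, ¬ r' x x := fun x h => H'.asymm _ _ h h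
  -- At absolute level `Z` an element is in the copied zone even with no rounds left, so a constant
  -- can act as a pebble.
  have hconst : ∀ c : L.Constants, Position L Z z r t z' r' t' 0 (c : M) (c : N) := by
    intro c
    have h1 := H.level_const c
    obtain ⟨k, hk⟩ := H.cover (c : M) (by omega)
    exact Or.inl ⟨k, hk, (eq_const_iff_of_color (H.color_eq k k) c).1 hk, by omega⟩
  rcases i with i | c
  · rcases j with j | c
    · fin_cases i <;> fin_cases j
      · exact iff_of_false (irr _) (irr' _)
      · exact hr
      · exact H.lt_swap H' hc hr
      · exact iff_of_false (irr _) (irr' _)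
    · fin_cases i
      · exact (H.position_const H' hZ ha c).1
      · exact (H.position_const H' hZ hb c).1
  · rcases j with j | c'
    · fin_cases j
      · exact (H.position_const H' hZ ha c).2
      · exact (H.position_const H' hZ hb c).2
    · exact (H.position_const H' hZ (hconst c) c').1

theorem Matched.realize_iff (hL : IsFiniteSignature L) {A B : FinStr.{u, v, w} L}
    {Z K k : ℕ} {z : A.Carrier → ℤ} {r : A.Carrier → A.Carrier → Prop} {t : Fin k → A.Carrier}
    {z' : B.Carrier → ℤ} {r' : B.Carrier → B.Carrier → Prop} {t' : Fin k → B.Carrier}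
    (H : Matched L Z K z r t z' r' t') (H' : Matched L Z K z' r' t' z r t)
    (hZ : 2 * K + 3 ≤ Z) {n : ℕ} (hn : n ≤ K) {φ : Formula2 (L.sum ltLang)} (hφ : φ.rank ≤ n)
    {s : Fin 2 → A.Carrier} {s' : Fin 2 → B.Carrier}
    (h : ∀ i, Position L Z z r t z' r' t' n (s i) (s' i))
    (hc : color L (s 0) (s 1) = color L (s' 0) (s' 1)) (hr : r (s 0) (s 1) ↔ r' (s' 0) (s' 1)) :
    φ.Realize (M := (A.expand r).Carrier) s ↔ φ.Realize (M := (B.expand r').Carrier) s' := by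
  refine Formula2.realize_iff_of_backAndForth (M := (A.expand r).Carrier)
    (N := (B.expand r').Carrier)
    (fun n s s' => (∀ i, Position L Z z r t z' r' t' n (s i) (s' i)) ∧
      color (M := A.Carrier) L (s 0) (s 1) = color (M := B.Carrier) L (s' 0) (s' 1) ∧
        (r (s 0) (s 1) ↔ r' (s' 0) (s' 1))) K ?_ ?_ ?_ ?_ φ n hn hφ s s' ⟨h, hc, hr⟩
  · rintro n s s' ⟨-, hc, -⟩ t₁ t₂
    obtain ⟨i, hi⟩ := exists_pairTerm hL t₁
    obtain ⟨j, hj⟩ := exists_pairTerm hL t₂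
    rw [hi A r, hj A r, hi B r', hj B r']
    exact pairEval_eq_iff hc i j
  · rintro n s s' ⟨hp, hc, hr⟩ m R ts
    choose g hg using fun k => exists_pairTerm hL (ts k)
    have hA := funext fun k => hg k A r s
    have hB := funext fun k => hg k B r' s'
    rw [hA, hB]
    rcases R with R | R
    · exact relMap_pairEval_iff hc R g
    · cases R
      exact H.pairEval_lt_iff H' (by omega) (hp 0) (hp 1) hc hr (g 0) (g 1)
  · rintro n hn s s' ⟨hp, hc, hr⟩ i a
    obtain ⟨b, -, hb⟩ := H.forth H' hn hZ hp i a
    exact ⟨b, hb⟩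
  · rintro n hn s s' ⟨hp, hc, hr⟩ i b
    obtain ⟨a, -, ha, hca, hra⟩ := H'.forth H hn hZ (fun i => H.position_symm (hp i)) i b
    exact ⟨a, fun i => H'.position_symm (ha i), hca.symm, hra.symm⟩

theorem Matched.models_of_models (hL : IsFiniteSignature L) {A B : FinStr.{u, v, w} L}
    {Z K k : ℕ} {z : A.Carrier → ℤ} {r : A.Carrier → A.Carrier → Prop} {t : Fin k → A.Carrier}
    {z' : B.Carrier → ℤ} {r' : B.Carrier → B.Carrier → Prop} {t' : Fin k → B.Carrier}
    (H : Matched L Z K z r t z' r' t') (H' : Matched L Z K z' r' t' z r t)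
    (hZ : 2 * K + 3 ≤ Z) {φ : Formula2 (L.sum ltLang)} (hφ : φ.rank + 2 ≤ K)
    (h : φ.Models (A.expand r)) : φ.Models (B.expand r') := by
  intro s'
  -- The assignment in `B` is answered in `A` by two moves, one for each variable; these are the two
  -- extra rounds in `φ.rank + 2 ≤ K`.
  obtain ⟨a, ha⟩ := H'.exists_position H (n := φ.rank + 1) (by omega) hZ (s' 0)
  obtain ⟨b, hb, hc, hr⟩ := H'.position_step H (n := φ.rank) (by omega) hZ ha (s' 1)
  refine (H.realize_iff hL H' hZ (by omega) le_rfl (s := ![a, b]) (s' := s') ?_ hc.symm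
    hr.symm).1 (h _)
  intro i
  fin_cases i
  · exact H'.position_symm (H'.position_mono H (by omega) hZ ha)
  · exact H'.position_symm hb

end Transfer

/-! ### Neighbourhoods in graphs of bounded degree -/

section Grow

variable {M : Type w} (adj : M → M → Prop)

/-- A set together with all neighbours of its elements. -/
def grow (S : Set M) : Set M := {y | y ∈ S ∨ ∃ x ∈ S, adj x y}

theorem subset_grow (S : Set M) : S ⊆ grow adj S := fun _ h => Or.inl h

theorem grow_mono {S T : Set M} (h : S ⊆ T) : grow adj S ⊆ grow adj T := by
  rintro y (hy | ⟨x, hx, hxy⟩)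
  · exact Or.inl (h hy)
  · exact Or.inr ⟨x, h hx, hxy⟩

theorem iterate_grow_mono {S T : Set M} (h : S ⊆ T) (k : ℕ) :
    (grow adj)^[k] S ⊆ (grow adj)^[k] T := by
  induction k with
  | zero => exact h
  | succ k ih =>
    rw [Function.iterate_succ_apply', Function.iterate_succ_apply']
    exact grow_mono adj ih

theorem iterate_grow_subset_of_le (S : Set M) {k l : ℕ} (h : k ≤ l) :
    (grow adj)^[k] S ⊆ (grow adj)^[l] S := by
  induction l, h using Nat.le_induction with
  | base => exact subset_rfl
  | succ l _ ih =>
    rw [Function.iterate_succ_apply']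
    exact ih.trans (subset_grow adj _)

theorem mem_iterate_grow_succ {S : Set M} {k : ℕ} {x y : M} (hx : x ∈ (grow adj)^[k] S)
    (h : adj x y) : y ∈ (grow adj)^[k + 1] S := by
  rw [Function.iterate_succ_apply']
  exact Or.inr ⟨x, hx, h⟩

theorem ncard_grow_le [Finite M] {d : ℕ} (hd : ∀ x, {y | adj x y}.ncard ≤ d) (S : Set M) :
    (grow adj S).ncard ≤ (d + 1) * S.ncard := by
  classical
  have hS := S.toFinite
  have h1 : grow adj S ⊆ ⋃ x ∈ hS.toFinset, insert x {y | adj x y} := by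
    rintro y (hy | ⟨x, hx, hxy⟩)
    · exact Set.mem_biUnion (x := y) (by simpa using hy) (Set.mem_insert _ _)
    · exact Set.mem_biUnion (x := x) (by simpa using hx) (Set.mem_insert_of_mem _ hxy)
  calc (grow adj S).ncard ≤ _ := Set.ncard_le_ncard h1 (Set.toFinite _)
    _ ≤ ∑ x ∈ hS.toFinset, (insert x {y | adj x y}).ncard := Finset.set_ncard_biUnion_le _ _
    _ ≤ ∑ x ∈ hS.toFinset, (d + 1) := Finset.sum_le_sum fun x _ =>
        (Set.ncard_insert_le _ _).trans (Nat.succ_le_succ (hd x))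
    _ = (d + 1) * S.ncard := by
        rw [Finset.sum_const, smul_eq_mul, Set.ncard_eq_toFinset_card S hS, mul_comm]

theorem ncard_iterate_grow_le [Finite M] {d : ℕ} (hd : ∀ x, {y | adj x y}.ncard ≤ d)
    (S : Set M) (k : ℕ) : ((grow adj)^[k] S).ncard ≤ (d + 1) ^ k * S.ncard := by
  induction k with
  | zero => simp
  | succ k ih =>
    rw [Function.iterate_succ_apply', pow_succ', mul_assoc]
    exact (ncard_grow_le adj hd _).trans (Nat.mul_le_mul_left _ ih)

theorem disjoint_grow_iff (hs : ∀ x y, adj x y → adj y x) (S T : Set M) :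
    Disjoint (grow adj S) T ↔ Disjoint S (grow adj T) := by
  simp only [Set.disjoint_left]
  constructor
  · rintro h x hx (hx' | ⟨y, hy, hyx⟩)
    · exact h (Or.inl hx) hx'
    · exact h (Or.inr ⟨x, hx, hs _ _ hyx⟩) hy
  · rintro h x (hx | ⟨y, hy, hyx⟩) hx'
    · exact h hx (Or.inl hx')
    · exact h hy (Or.inr ⟨x, hx', hs _ _ hyx⟩)

theorem disjoint_iterate_grow_iff (hs : ∀ x y, adj x y → adj y x) (k : ℕ) (S T : Set M) :
    Disjoint ((grow adj)^[k] S) T ↔ Disjoint S ((grow adj)^[k] T) := by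
  induction k generalizing T with
  | zero => rfl
  | succ k ih =>
    rw [Function.iterate_succ_apply', disjoint_grow_iff adj hs, ih, Function.iterate_succ_apply]

open Classical in
/-- The function with value `l` on `S` that decreases by one with each step away from `S`. -/
noncomputable def bump (S : Set M) (l : ℕ) (x : M) : ℕ :=
  ∑ k ∈ Finset.range l, if x ∈ (grow adj)^[k] S then 1 else 0

theorem bump_of_mem {S : Set M} {x : M} (hx : x ∈ S) (l : ℕ) : bump adj S l x = l := by
  have h : ∀ k, x ∈ (grow adj)^[k] S := fun k =>
    iterate_grow_subset_of_le adj S (Nat.zero_le k) hx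
  simp [bump, h]

theorem exists_mem_of_bump_ne_zero {S : Set M} {l : ℕ} {x : M} (h : bump adj S l x ≠ 0) :
    ∃ k < l, x ∈ (grow adj)^[k] S := by
  obtain ⟨k, hk, hx⟩ := Finset.exists_ne_zero_of_sum_ne_zero h
  exact ⟨k, Finset.mem_range.1 hk, by simpa using hx⟩

theorem mem_of_bump_ne_zero {S : Set M} {l : ℕ} {x : M} (h : bump adj S l x ≠ 0) :
    x ∈ (grow adj)^[l] S := by
  obtain ⟨k, hk, hx⟩ := exists_mem_of_bump_ne_zero adj h
  exact iterate_grow_subset_of_le adj S hk.le hx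

theorem bump_le (S : Set M) (l : ℕ) (x : M) : bump adj S l x ≤ l := by
  classical
  refine (Finset.sum_le_card_nsmul _ _ 1 fun k _ => ?_).trans (by simp)
  split_ifs <;> simp

/-- If `x` is within `k` steps of `S` then `y` is within `k + 1`, and shifting the summation index
by one costs at most one summand. -/
theorem bump_le_succ (S : Set M) (l : ℕ) {x y : M} (h : adj x y) :
    bump adj S l x ≤ bump adj S l y + 1 := by
  classical
  calc bump adj S l x ≤ ∑ k ∈ Finset.range l, if y ∈ (grow adj)^[k + 1] S then 1 else 0 := by
        refine Finset.sum_le_sum fun k _ => ?_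
        by_cases hx : x ∈ (grow adj)^[k] S
        · rw [if_pos hx, if_pos (mem_iterate_grow_succ adj hx h)]
        · rw [if_neg hx]
          exact Nat.zero_le _
    _ ≤ ∑ k ∈ Finset.range (l + 1), if y ∈ (grow adj)^[k] S then 1 else 0 := by
        rw [Finset.sum_range_succ']
        exact Nat.le_add_right _ _
    _ ≤ bump adj S l y + 1 := by
        rw [Finset.sum_range_succ, bump]
        gcongr
        split_ifs <;> simp

end Grow

/-! ### Separating rare and frequent types -/

/-- A type with at most `g c` realizations is discarded and its realizations join the core, whose
bound grows from `c` to `c + g c`. This happens at most `k` times, so the final bound depends only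
on `g`, `k` and `c`, although "frequent" is measured against the growing core. -/
theorem exists_frequent (g : ℕ → ℕ) (k c : ℕ) : ∃ b, ∀ {X : Type w} {Y : Type v} [Finite X]
    (rel : X → Y → Prop) (T : Finset Y) (C : Set X), T.card = k → C.ncard ≤ c →
      (∀ x, x ∈ C ∨ ∃ y ∈ T, rel x y) →
      ∃ c' ≤ b, ∃ (T' : Finset Y) (C' : Set X), C ⊆ C' ∧ C'.ncard ≤ c' ∧
        (∀ x, x ∈ C' ∨ ∃ y ∈ T', rel x y) ∧ ∀ y ∈ T', g c' < {x | rel x y}.ncard := by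
  classical
  induction k generalizing c with
  | zero =>
    refine ⟨c, fun rel T C hT hC h => ⟨c, le_rfl, T, C, subset_rfl, hC, h, ?_⟩⟩
    rw [Finset.card_eq_zero] at hT
    simp [hT]
  | succ k ih =>
    obtain ⟨b, hb⟩ := ih (c + g c)
    refine ⟨max b c, fun {X Y} _ rel T C hT hC h => ?_⟩
    by_cases hg : ∀ y ∈ T, g c < {x | rel x y}.ncard
    · exact ⟨c, le_max_right _ _, T, C, subset_rfl, hC, h, hg⟩
    · push Not at hg
      obtain ⟨y, hy, hyc⟩ := hg
      obtain ⟨c', hc', T', C', hCC', h'⟩ := hb rel (T.erase y) (C ∪ {x | rel x y})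
        (by rw [Finset.card_erase_of_mem hy, hT]; rfl)
        ((Set.ncard_union_le _ _).trans (add_le_add hC hyc)) (by
          intro x
          rcases h x with hx | ⟨y', hy', hxy'⟩
          · exact Or.inl (Or.inl hx)
          · by_cases hyy : y' = y
            · subst hyy
              exact Or.inl (Or.inr hxy')
            · exact Or.inr ⟨y', Finset.mem_erase.2 ⟨hyy, hy'⟩, hxy'⟩)
      exact ⟨c', hc'.trans (le_max_left _ _), T', C', Set.subset_union_left.trans hCC', h'⟩

/-! ### Placing prescribed patches at prescribed levels -/

section Patches

theorem natAbs_add_bump_sub_le {e a b : ℤ} {k l : ℕ} (he : e = 1 ∨ e = -1)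
    (hab : (a - b).natAbs ≤ 1) (hkl : k ≤ l + 1) (hlk : l ≤ k + 1) (hk : k ≠ 0 → a = 0 ∧ b = 0)
    (hl : l ≠ 0 → a = 0 ∧ b = 0) : (a + e * k - (b + e * l)).natAbs ≤ 1 := by
  by_cases hk0 : k = 0
  · by_cases hl0 : l = 0
    · simpa [hk0, hl0] using hab
    · obtain ⟨rfl, rfl⟩ := hl hl0
      rcases he with rfl | rfl <;> omega
  · obtain ⟨rfl, rfl⟩ := hk hk0
    rcases he with rfl | rfl <;> omega

variable {M : Type w} [Finite M] {adj : M → M → Prop} {m : ℕ}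

/-- Greedy placement: the set of nonzero level is small compared with the number of possible
centres, so each request finds a patch far from it. Adding a bump of the prescribed sign and height
there disturbs nothing placed earlier. -/
theorem exists_levels {d : ℕ} (hs : ∀ x y, adj x y → adj y x)
    (hd : ∀ x, {y | adj x y}.ncard ≤ d) (ρ Z : ℕ) {R : Type*}
    (U : R → Set (Fin (m + 1) → M)) (lev : R → ℤ) (p : R → Fin (m + 1) → ℕ)
    (z₀ : M → ℤ) (hz₀ : ∀ x y, adj x y → (z₀ x - z₀ y).natAbs ≤ 1)
    (F : Finset R) (hlev : ∀ r ∈ F, lev r ≠ 0 ∧ (lev r).natAbs ≤ Z)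
    (hU : ∀ r ∈ F, ∀ u ∈ U r, Set.range u ⊆ (grow adj)^[ρ] {u 0} ∧ ∀ i j, u i = u j → p r i = p r j)
    (hcard : ∀ r ∈ F, (d + 1) ^ (ρ + Z + 1) *
      ({x | z₀ x ≠ 0}.ncard + F.card * (d + 1) ^ (ρ + Z)) < ((fun u => u 0) '' U r).ncard) :
    ∃ (z : M → ℤ) (tie : M → ℕ), (∀ x y, adj x y → (z x - z y).natAbs ≤ 1) ∧
      (∀ x, z₀ x ≠ 0 → z x = z₀ x) ∧
      {x | z x ≠ 0}.ncard ≤ {x | z₀ x ≠ 0}.ncard + F.card * (d + 1) ^ (ρ + Z) ∧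
      ∀ r ∈ F, ∃ u ∈ U r, ∀ i, z (u i) = lev r ∧ tie (u i) = p r i := by
  classical
  induction F using Finset.induction_on with
  | empty => exact ⟨z₀, fun _ => 0, hz₀, fun _ _ => rfl, by simp, by simp⟩
  | insert r F hr ih =>
    rw [Finset.card_insert_of_notMem hr] at hcard ⊢
    obtain ⟨z, tie, hz, hz0, hzc, hF⟩ := ih (fun r' h => hlev r' (Finset.mem_insert_of_mem h))
      (fun r' h => hU r' (Finset.mem_insert_of_mem h)) (fun r' h => lt_of_le_of_lt
        (Nat.mul_le_mul_left _ (Nat.add_le_add_left (Nat.mul_le_mul_right _ (Nat.le_succ _)) _))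
        (hcard r' (Finset.mem_insert_of_mem h)))
    obtain ⟨hl0, hlZ⟩ := hlev r (Finset.mem_insert_self r F)
    have hUr := hU r (Finset.mem_insert_self r F)
    set S := {x | z x ≠ 0} with hS
    -- The distance must exceed `ρ` for the patch, `Z` for the fading bump, and one more step so
    -- that also the neighbours of the bump's support have level `0`.
    have hfar : ∃ u ∈ U r, u 0 ∉ (grow adj)^[ρ + Z + 1] S := by
      by_contra! hcon
      have h1 : (fun u => u 0) '' U r ⊆ (grow adj)^[ρ + Z + 1] S := by
        rintro _ ⟨u, hu, rfl⟩
        exact hcon u hu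
      have h2 := (Set.ncard_le_ncard h1 (Set.toFinite _)).trans
        (ncard_iterate_grow_le adj hd S (ρ + Z + 1))
      have h3 := hcard r (Finset.mem_insert_self r F)
      refine absurd (h3.trans_le h2) (not_lt.2 (Nat.mul_le_mul_left _ (hzc.trans ?_)))
      exact Nat.add_le_add_left (Nat.mul_le_mul_right _ (Nat.le_succ _)) _
    obtain ⟨u, huU, hu⟩ := hfar
    obtain ⟨hur, hup⟩ := hUr u huU
    have hdisj : Disjoint ((grow adj)^[ρ + Z + 1] {u 0}) S := by
      rw [disjoint_iterate_grow_iff adj hs]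
      exact Set.disjoint_singleton_left.2 hu
    have hgrow : ∀ k, k ≤ Z + 1 →
        (grow adj)^[k] (Set.range u) ⊆ (grow adj)^[ρ + Z + 1] {u 0} := by
      intro k hk
      refine (iterate_grow_mono adj hur k).trans ?_
      rw [← Function.iterate_add_apply]
      exact iterate_grow_subset_of_le adj _ (by omega)
    set l := (lev r).natAbs with hl
    have hb : ∀ x, bump adj (Set.range u) l x ≠ 0 → z x = 0 ∧ ∀ y, adj x y → z y = 0 := by
      intro x hx
      have h1 := mem_of_bump_ne_zero adj hx
      refine ⟨?_, fun y hy => ?_⟩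
      · have := Set.disjoint_left.1 hdisj (hgrow l (by omega) h1)
        simpa [hS] using this
      · have := Set.disjoint_left.1 hdisj (hgrow (l + 1) (by omega)
          (mem_iterate_grow_succ adj h1 hy))
        simpa [hS] using this
    -- The tuple `u` may repeat elements; the chosen index is harmless because `p r` agrees on
    -- indices of equal elements.
    refine ⟨fun x => z x + (lev r).sign * bump adj (Set.range u) l x,
      fun x => if h : ∃ i, u i = x then p r h.choose else tie x, ?_, ?_, ?_, ?_⟩
    · intro x y hxy
      have h1 := hz x y hxy
      have h2 := bump_le_succ adj (Set.range u) l hxy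
      have h3 := bump_le_succ adj (Set.range u) l (hs _ _ hxy)
      have h4 : bump adj (Set.range u) l x ≠ 0 → z x = 0 ∧ z y = 0 := fun h =>
        ⟨(hb x h).1, (hb x h).2 y hxy⟩
      have h5 : bump adj (Set.range u) l y ≠ 0 → z x = 0 ∧ z y = 0 := fun h =>
        ⟨(hb y h).2 x (hs _ _ hxy), (hb y h).1⟩
      have hsgn : (lev r).sign = 1 ∨ (lev r).sign = -1 := by
        rcases lt_or_gt_of_ne hl0 with h | h
        · exact Or.inr (Int.sign_eq_neg_one_of_neg h)
        · exact Or.inl (Int.sign_eq_one_of_pos h)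
      exact natAbs_add_bump_sub_le hsgn h1 h2 h3 h4 h5
    · intro x hx
      have h1 : bump adj (Set.range u) l x = 0 := by
        by_contra h
        exact hx (by rw [← hz0 x hx]; exact (hb x h).1)
      simp [h1, hz0 x hx]
    · have h1 : {x | z x + (lev r).sign * (bump adj (Set.range u) l x : ℤ) ≠ 0} ⊆
          S ∪ (grow adj)^[ρ + Z] {u 0} := by
        intro x hx
        by_cases hzx : z x = 0
        · refine Or.inr ?_
          have h2 : bump adj (Set.range u) l x ≠ 0 := by
            intro h
            simp [hzx, h] at hx
          have h3 := iterate_grow_mono adj hur l (mem_of_bump_ne_zero adj h2)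
          rw [← Function.iterate_add_apply] at h3
          exact iterate_grow_subset_of_le adj _ (by omega) h3
        · exact Or.inl hzx
      have h2 := ncard_iterate_grow_le adj hd {u 0} (ρ + Z)
      rw [Set.ncard_singleton, mul_one] at h2
      calc _ ≤ _ := Set.ncard_le_ncard h1 (Set.toFinite _)
        _ ≤ _ := Set.ncard_union_le _ _
        _ ≤ _ := add_le_add hzc h2
        _ = _ := by ring
    · intro r' hr'
      rcases Finset.mem_insert.1 hr' with rfl | hr'
      · refine ⟨u, huU, fun i => ⟨?_, ?_⟩⟩
        · have h1 : bump adj (Set.range u) l (u i) = l := bump_of_mem adj (Set.mem_range_self i) l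
          have h2 := (hb (u i) (by rw [h1]; omega)).1
          dsimp only
          rw [h1, h2, zero_add, hl]
          exact Int.sign_mul_natAbs _
        · have h : ∃ j, u j = u i := ⟨i, rfl⟩
          dsimp only
          rw [dif_pos h]
          exact hup _ _ h.choose_spec
      · obtain ⟨u', hu', h'⟩ := hF r' hr'
        refine ⟨u', hu', fun i => ?_⟩
        have hne : z (u' i) ≠ 0 := by
          rw [(h' i).1]
          exact (hlev r' (Finset.mem_insert_of_mem hr')).1
        have h1 : bump adj (Set.range u) l (u' i) = 0 := by
          by_contra h
          exact hne (hb _ h).1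
        have h2 : ¬ ∃ j, u j = u' i := by
          rintro ⟨j, hj⟩
          have : bump adj (Set.range u) l (u' i) = l := bump_of_mem adj (Set.mem_range.2 ⟨j, hj⟩) l
          omega
        dsimp only
        rw [h1, dif_neg h2]
        simpa using h' i

end Patches

/-! ### Local types and layouts -/

section Layout

variable {L : FirstOrder.Language.{u, v}} {M : Type w} [L.Structure M]

variable (L) in
/-- Descriptions of finite neighbourhoods: the colors of pairs, and the fuel of each element. -/
abbrev LocalType (m K : ℕ) :=
  (Fin (m + 1) → Fin (m + 1) → Color L) × (Fin (m + 1) → Fin (K + 1))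

/-- The tuple `u` lists a neighbourhood of radius at least `K` of `u 0` that is described
by `τ`. -/
structure HasType {m K : ℕ} (u : Fin (m + 1) → M) (τ : LocalType L m K) : Prop where
  color_eq : ∀ i j, color L (u i) (u j) = τ.1 i j
  insulated : Insulated L u fun i => τ.2 i
  center : (τ.2 0 : ℕ) = K

/-- A linear ordering, given by ranks, of a neighbourhood described by `τ`. -/
def IsPattern {m K : ℕ} (τ : LocalType L m K) (p : Fin (m + 1) → Fin (m + 1)) : Prop :=
  ∀ i j, p i = p j ↔ (τ.1 i j).1 (Sum.inl 0) (Sum.inl 1)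

variable (L) in
/-- All orderings of all neighbourhoods described in `T` occur at all levels at distance at most
`K` from the extreme levels `Z` and `-Z`. -/
def Supplies {m K : ℕ} (Z : ℕ) (z : M → ℤ) (r : M → M → Prop) (T : Set (LocalType L m K)) :
    Prop :=
  ∀ τ ∈ T, ∀ p, IsPattern τ p → ∀ l : ℕ, 1 ≤ l → l ≤ K → ∀ s : ℤ, s = 1 ∨ s = -1 →
    ∃ w, HasType w τ ∧ (∀ i, z (w i) = s * (Z - l)) ∧ ∀ i j, p i < p j ↔ r (w i) (w j)

/-- The order by levels, ties being broken by `q`. -/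
def levelLT (z : M → ℤ) (q : M → ℕ) (x y : M) : Prop := z x < z y ∨ z x = z y ∧ q x < q y

theorem levelLT_isStrictTotalOrder {z : M → ℤ} {q : M → ℕ}
    (h : ∀ x y, z x = z y → q x = q y → x = y) : IsStrictTotalOrder M (levelLT z q) where
  irrefl a := by simp only [levelLT]; omega
  trans a b c := by simp only [levelLT]; omega
  trichotomous a b hab hba := by
    simp only [levelLT] at hab hba
    exact h a b (by omega) (by omega)

theorem exists_hasType [Finite M] {d : ℕ} (hd : ∀ x : M, {y | Linked L x y}.ncard ≤ d) (K : ℕ)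
    (x : M) : ∃ (τ : LocalType L ((d + 1) ^ K) K) (u : Fin ((d + 1) ^ K + 1) → M),
      u 0 = x ∧ HasType u τ ∧ Set.range u ⊆ (grow (Linked L))^[K] {x} := by
  classical
  set S := (grow (Linked L))^[K] {x} with hS
  have hxS : x ∈ S := iterate_grow_subset_of_le _ _ (Nat.zero_le K) rfl
  have hc : Nat.card S ≤ (d + 1) ^ K := by
    simpa using ncard_iterate_grow_le (Linked L) hd {x} K
  let e : S ≃ Fin (Nat.card S) := Finite.equivFin S
  -- The centre comes first, then the ball of radius `K`; surplus positions repeat the centre so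
  -- that all tuples have the same length.
  let u : Fin ((d + 1) ^ K + 1) → M :=
    Fin.cons x fun i => if h : (i : ℕ) < Nat.card S then (e.symm ⟨i, h⟩ : M) else x
  have hu0 : u 0 = x := rfl
  have hu : ∀ y ∈ S, ∃ i, u i = y := by
    intro y hy
    refine ⟨Fin.succ ⟨e ⟨y, hy⟩, (e ⟨y, hy⟩).2.trans_le hc⟩, ?_⟩
    change (if h : ((e ⟨y, hy⟩ : Fin (Nat.card S)) : ℕ) < Nat.card S then
      (e.symm ⟨e ⟨y, hy⟩, h⟩ : M) else x) = y
    rw [dif_pos (e ⟨y, hy⟩).2]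
    exact congrArg Subtype.val (e.symm_apply_apply _)
  -- The fuel is `K` at the centre and falls by one with each step, so positive fuel means that all
  -- linked elements are still in the ball.
  refine ⟨(fun i j => color L (u i) (u j),
    fun i => ⟨bump (Linked L) {x} K (u i), Nat.lt_succ_of_le (bump_le _ _ _ _)⟩), u, hu0,
    ⟨fun _ _ => rfl, ?_, ?_⟩, ?_⟩
  · intro i hi y hy
    dsimp only at hi
    obtain ⟨k, hk, hik⟩ := exists_mem_of_bump_ne_zero (Linked L) (Nat.one_le_iff_ne_zero.1 hi)
    have hyS : y ∈ S :=
      iterate_grow_subset_of_le _ _ (Nat.succ_le_of_lt hk) (mem_iterate_grow_succ _ hik hy)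
    obtain ⟨j, rfl⟩ := hu y hyS
    exact ⟨j, rfl, bump_le_succ _ _ _ hy⟩
  · exact bump_of_mem _ (Set.mem_singleton_iff.2 hu0) K
  · rintro _ ⟨i, rfl⟩
    refine Fin.cases hxS (fun i => ?_) i
    simp only [u, Fin.cons_succ]
    split_ifs
    · exact Subtype.coe_prop _
    · exact hxS

theorem exists_layout (hL : IsFiniteSignature L) (d K Z : ℕ) (hKZ : K < Z) :
    ∃ b, ∀ A : FinStr.{u, v, w} L, DegreeLE A d →
      ∃ (z : A.Carrier → ℤ) (q : A.Carrier → ℕ) (T : Set (LocalType L ((d + 1) ^ K) K)),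
        Function.Injective q ∧ (∀ x y, Linked L x y → (z x - z y).natAbs ≤ 1) ∧
        (∀ c : L.Constants, z (c : A.Carrier) = -Z) ∧ {x | z x ≠ 0}.ncard ≤ b ∧
        (∀ x, z x = -Z ∨ ∃ τ ∈ T, ∃ u, u 0 = x ∧ HasType u τ) ∧
        Supplies L Z z (levelLT z q) T := by
  classical
  have := finite_color hL
  have := finite_constants hL
  set m := (d + 1) ^ K with hm
  let R := LocalType L m K × (Fin (m + 1) → Fin (m + 1)) × Fin K × Bool
  have hR : Finite R := inferInstance
  let _ := Fintype.ofFinite R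
  let _ := Fintype.ofFinite (LocalType L m K)
  -- The threshold is the size bound of the `(K + Z + 1)`-neighbourhood of all that is ever laid
  -- out: the fading core, plus one patch with its bump for each possible request.
  obtain ⟨b, hb⟩ := exists_frequent.{max u v, w}
    (fun c => (d + 1) ^ (K + Z + 1) * ((d + 1) ^ Z * c + Fintype.card R * (d + 1) ^ (K + Z)))
    (Fintype.card (LocalType L m K)) (Nat.card L.Constants)
  refine ⟨(d + 1) ^ Z * b + Fintype.card R * (d + 1) ^ (K + Z), fun A hA => ?_⟩
  have hd : ∀ x : A.Carrier, {y | Linked L x y}.ncard ≤ d := fun x =>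
    (Set.ncard_le_ncard (fun y hy => hy.gaifman) (Set.toFinite _)).trans (hA x)
  have hs : ∀ x y : A.Carrier, Linked L x y → Linked L y x := fun x y h => h.symm
  let U : LocalType L m K → Set (Fin (m + 1) → A.Carrier) := fun τ =>
    {u | HasType u τ ∧ Set.range u ⊆ (grow (Linked L))^[K] {u 0}}
  obtain ⟨c, hcb, T, C, hCC, hCc, hcov, hT⟩ := hb (fun (x : A.Carrier) τ => ∃ u ∈ U τ, u 0 = x)
    Finset.univ (Set.range fun c : L.Constants => (c : A.Carrier)) rfl
    (by
      rw [← Set.image_univ]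
      exact (Set.ncard_image_le (Set.toFinite _)).trans (by rw [Set.ncard_univ]))
    (fun x => by
      obtain ⟨τ, u, hu0, hu, hr⟩ := exists_hasType hd K x
      exact Or.inr ⟨τ, Finset.mem_univ _, u, ⟨hu, by rwa [hu0]⟩, hu0⟩)
  let z₀ : A.Carrier → ℤ := fun x => -(bump (Linked L) C Z x : ℤ)
  have hz₀ : ∀ x y, Linked L x y → (z₀ x - z₀ y).natAbs ≤ 1 := by
    intro x y hxy
    have h1 := bump_le_succ _ C Z hxy
    have h2 := bump_le_succ _ C Z hxy.symm
    simp only [z₀]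
    omega
  have hz₀c : {x | z₀ x ≠ 0}.ncard ≤ (d + 1) ^ Z * c := by
    have h1 : {x | z₀ x ≠ 0} ⊆ (grow (Linked L))^[Z] C := fun x hx =>
      mem_of_bump_ne_zero _ (by simpa [z₀] using hx)
    exact (Set.ncard_le_ncard h1 (Set.toFinite _)).trans
      ((ncard_iterate_grow_le _ hd C Z).trans (Nat.mul_le_mul_left _ hCc))
  -- A request stores `l - 1` in `Fin K`, whence the `+ 1`.
  let lev : R → ℤ := fun r => (if r.2.2.2 then 1 else -1) * (Z - ((r.2.2.1 : ℕ) + 1 : ℕ))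
  let F : Finset R := Finset.univ.filter fun r => r.1 ∈ T ∧ IsPattern r.1 r.2.1
  have hFR : F.card ≤ Fintype.card R := Finset.card_le_univ F
  obtain ⟨z, tie, hz, hz0, hzc, hF⟩ := exists_levels hs hd K Z (fun r : R => U r.1) lev
    (fun r i => (r.2.1 i : ℕ)) z₀ hz₀ F
    (by
      intro r _
      have := r.2.2.1.2
      simp only [lev]
      split_ifs <;> omega)
    (by
      intro r hr u hu
      refine ⟨hu.2, fun i j hij => ?_⟩
      rw [Fin.val_inj, (Finset.mem_filter.1 hr).2.2 i j, ← hu.1.color_eq]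
      exact hij)
    (by
      intro r hr
      refine lt_of_le_of_lt (Nat.mul_le_mul_left _ (add_le_add hz₀c
        (Nat.mul_le_mul_right _ hFR))) (hT r.1 (Finset.mem_filter.1 hr).2.1))
  let e := Finite.equivFin A.Carrier
  -- Lexicographic: the prescribed ranks take precedence, and an enumeration makes the tie-breaker
  -- injective.
  let q : A.Carrier → ℕ := fun x => tie x * Nat.card A.Carrier + e x
  have hq : ∀ x y, tie x < tie y → q x < q y := by
    intro x y h
    have h1 := Nat.mul_le_mul_right (Nat.card A.Carrier) (Nat.succ_le_of_lt h)
    rw [Nat.succ_mul] at h1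
    have h2 := (e x).2
    simp only [q]
    omega
  have hq_inj : Function.Injective q := by
    intro x y hxy
    rcases lt_trichotomy (tie x) (tie y) with h | h | h
    · exact absurd hxy (hq _ _ h).ne
    · have : (e x : ℕ) = e y := by
        simp only [q, h] at hxy
        omega
      exact e.injective (Fin.ext this)
    · exact absurd hxy (hq _ _ h).ne'
  have hzC : ∀ x ∈ C, z x = -Z := by
    intro x hx
    have h1 : z₀ x = -Z := by simp only [z₀, bump_of_mem _ hx]
    rw [hz0 x (by omega), h1]
  refine ⟨z, q, T, hq_inj, hz, fun c => hzC _ (hCC ⟨c, rfl⟩), ?_, ?_, ?_⟩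
  · exact hzc.trans (add_le_add (hz₀c.trans (Nat.mul_le_mul_left _ hcb))
      (Nat.mul_le_mul_right _ hFR))
  · intro x
    rcases hcov x with hx | ⟨τ, hτ, u, hu, hux⟩
    · exact Or.inl (hzC x hx)
    · exact Or.inr ⟨τ, hτ, u, hux, hu.1⟩
  · intro τ hτ p hp l hl1 hlK s hs
    obtain ⟨w, hw, hw'⟩ := hF (τ, p, ⟨l - 1, by omega⟩, decide (s = 1))
      (Finset.mem_filter.2 ⟨Finset.mem_univ _, hτ, hp⟩)
    have hzw : ∀ i, z (w i) = s * (Z - l) := by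
      intro i
      rw [(hw' i).1]
      have hl : ((l - 1 + 1 : ℕ) : ℤ) = l := by omega
      change (if decide (s = 1) then (1 : ℤ) else -1) * (Z - ((l - 1 + 1 : ℕ) : ℤ)) = _
      rw [hl]
      rcases hs with rfl | rfl <;> simp
    refine ⟨w, hw.1, hzw, fun i j => ?_⟩
    have hti := (hw' i).2
    have htj := (hw' j).2
    simp only [levelLT, hzw, lt_irrefl, true_and, false_or]
    constructor
    · intro h
      exact hq _ _ (by rw [hti, htj]; exact h)
    · intro h
      by_contra hn
      rcases (not_lt.1 hn).lt_or_eq with hlt | heq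
      · exact absurd (hq (w j) (w i) (by rw [hti, htj]; exact hlt)) h.not_gt
      · have : w i = w j := by
          have h1 := (hp i j).1 heq.symm
          rw [← hw.1.color_eq] at h1
          exact h1
        rw [this] at h
        exact lt_irrefl _ h

end Layout

/-! ### Copying a layout to another structure -/

section Copy

variable {L : FirstOrder.Language.{u, v}} {M N : Type w} [L.Structure M] [L.Structure N]

/-- The rank of an index is the number of indices whose entries lie strictly below its entry, so
repeated entries share a rank and `m + 1` ranks suffice. -/
theorem exists_rank {m : ℕ} {r : M → M → Prop} (hr : IsStrictTotalOrder M r)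
    (x : Fin (m + 1) → M) : ∃ p : Fin (m + 1) → Fin (m + 1),
      (∀ i j, p i = p j ↔ x i = x j) ∧ ∀ i j, p i < p j ↔ r (x i) (x j) := by
  classical
  let s : Fin (m + 1) → Finset (Fin (m + 1)) := fun i => Finset.univ.filter fun j => r (x j) (x i)
  have hs : ∀ i, (s i).card < m + 1 := by
    intro i
    have h1 : s i ⊂ Finset.univ := (Finset.ssubset_univ_iff).2 fun h =>
      hr.irrefl (x i) (Finset.mem_filter.1 (h ▸ Finset.mem_univ i : i ∈ s i)).2
    simpa using Finset.card_lt_card h1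
  have hlt : ∀ i j, r (x i) (x j) → (s i).card < (s j).card := by
    intro i j hij
    refine Finset.card_lt_card (Finset.ssubset_iff_of_subset ?_ |>.2 ⟨i, ?_, ?_⟩)
    · intro k hk
      simp only [s, Finset.mem_filter, Finset.mem_univ, true_and] at hk ⊢
      exact hr.trans _ _ _ hk hij
    · simpa [s] using hij
    · simpa [s] using hr.irrefl (x i)
  have heq : ∀ i j, x i = x j → (s i).card = (s j).card := fun i j h => by simp only [s, h]
  have htri : ∀ i j, r (x i) (x j) ∨ x i = x j ∨ r (x j) (x i) := by
    intro i j
    by_contra! h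
    exact h.2.1 (hr.trichotomous _ _ h.1 h.2.2)
  refine ⟨fun i => ⟨(s i).card, hs i⟩, fun i j => ?_, fun i j => ?_⟩
  · rw [Fin.mk.injEq]
    refine ⟨fun h => ?_, heq i j⟩
    rcases htri i j with h1 | h1 | h1
    · exact absurd h (hlt _ _ h1).ne
    · exact h1
    · exact absurd h (hlt _ _ h1).ne'
  · rw [Fin.mk_lt_mk]
    refine ⟨fun h => ?_, hlt i j⟩
    rcases htri i j with h1 | h1 | h1
    · exact h1
    · exact absurd (heq _ _ h1) h.ne
    · exact absurd (hlt _ _ h1) h.not_gt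

/-- The neighbourhood of `x` is ordered by `r` in some pattern, and the other structure supplies
that very pattern at the requested level. The whole patch has constant level, hence so do the
neighbours of its centre. -/
theorem exists_localSim_of_supplies {m K Z : ℕ} {z : M → ℤ} {r : M → M → Prop} {z' : N → ℤ}
    {r' : N → N → Prop} {T : Set (LocalType L m K)} (hr : IsStrictTotalOrder M r)
    (hcov : ∀ x, z x = -Z ∨ ∃ τ ∈ T, ∃ u, u 0 = x ∧ HasType u τ) (hsup : Supplies L Z z' r' T)
    (x : M) (hx : z x ≠ -Z) (l : ℕ) (hl : 1 ≤ l) (hlK : l ≤ K) (s : ℤ) (hs : s = 1 ∨ s = -1) :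
    ∃ y, z' y = s * (Z - l) ∧ (∀ y', Linked L y y' → z' y' = z' y) ∧ LocalSim L r r' K x y := by
  rcases hcov x with h | ⟨τ, hτ, u, rfl, hu⟩
  · exact absurd h hx
  · obtain ⟨p, hpe, hpl⟩ := exists_rank hr u
    have hp : IsPattern τ p := by
      intro i j
      rw [hpe, ← hu.color_eq]
      exact Iff.rfl
    obtain ⟨w, hw, hwz, hwp⟩ := hsup τ hτ p hp l hl hlK s hs
    refine ⟨w 0, hwz 0, fun y' hy' => ?_, m + 1, u, w, fun i => τ.2 i, 0, rfl, rfl, hu.center.ge,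
      hu.insulated, hw.insulated, fun i j => ⟨?_, ?_⟩⟩
    · obtain ⟨j, rfl, -⟩ := hw.insulated 0 (by have := hw.center; dsimp only; omega) y' hy'
      rw [hwz, hwz]
    · rw [hu.color_eq, hw.color_eq]
    · rw [← hpl, hwp]

/-- The tuple `t` has diagram `D`, it contains all elements linked to those with index in `inner`,
and all elements except for those with index in `core` have local types in `T`. -/
structure Fits {k m K : ℕ} (D : Fin k → Fin k → Color L) (core inner : Set (Fin k))
    (T : Set (LocalType L m K)) (t : Fin k → M) : Prop where
  color_eq : ∀ i j, color L (t i) (t j) = D i j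
  closed : ∀ i ∈ inner, ∀ y, Linked L (t i) y → ∃ j, t j = y
  cover : ∀ y, (∃ i ∈ core, t i = y) ∨ ∃ τ ∈ T, ∃ u, u 0 = y ∧ HasType u τ

/-- Levels and tie-breakers are carried along `t i ↦ t' i`. Every patch lies at absolute level at
least `2`, where the copy is closed under links, so the patches remain insulated in the second
structure. -/
theorem exists_matched [Finite N] {m K Z k : ℕ} (hZ : 2 * K + 3 ≤ Z)
    {z : M → ℤ} {q : M → ℕ} {T : Set (LocalType L m K)} (hq : Function.Injective q)
    (hz : ∀ x y, Linked L x y → (z x - z y).natAbs ≤ 1)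
    (hc : ∀ c : L.Constants, z (c : M) = -Z)
    (hcov : ∀ x, z x = -Z ∨ ∃ τ ∈ T, ∃ u, u 0 = x ∧ HasType u τ)
    (hsup : Supplies L Z z (levelLT z q) T) {t : Fin k → M} (ht : ∀ x, z x ≠ 0 ↔ ∃ i, t i = x)
    {t' : Fin k → N}
    (hfit : Fits (fun i j => color L (t i) (t j)) {i | z (t i) = -Z} {i | 2 ≤ (z (t i)).natAbs} T
      t') :
    ∃ (z' : N → ℤ) (r' : N → N → Prop), IsStrictTotalOrder N r' ∧
      Matched L Z K z (levelLT z q) t z' r' t' ∧ Matched L Z K z' r' t' z (levelLT z q) t := by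
  classical
  have hcol : ∀ i j, color L (t i) (t j) = color L (t' i) (t' j) := fun i j =>
    (hfit.color_eq i j).symm
  have hteq : ∀ i j, t i = t j ↔ t' i = t' j := fun i j => eq_iff_of_color (hcol i j)
  have hne : ∀ i, z (t i) ≠ 0 := fun i => (ht _).2 ⟨i, rfl⟩
  let e := Finite.equivFin N
  -- Independent of the chosen index, since `t` and `t'` satisfy the same equalities. Outside the
  -- copy the level is `0`, which no copied element has, so copied and default tie-breakers never
  -- compete.
  let z' : N → ℤ := fun y => if h : ∃ i, t' i = y then z (t h.choose) else 0
  let q' : N → ℕ := fun y => if h : ∃ i, t' i = y then q (t h.choose) else e y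
  have hch : ∀ i (h : ∃ j, t' j = t' i), t h.choose = t i := fun i h =>
    (hteq _ _).2 h.choose_spec
  have hz't : ∀ i, z' (t' i) = z (t i) := by
    intro i
    have h : ∃ j, t' j = t' i := ⟨i, rfl⟩
    simp only [z', dif_pos h, hch i h]
  have hq't : ∀ i, q' (t' i) = q (t i) := by
    intro i
    have h : ∃ j, t' j = t' i := ⟨i, rfl⟩
    simp only [q', dif_pos h, hch i h]
  have hz'0 : ∀ y, (¬ ∃ i, t' i = y) → z' y = 0 := fun y h => by simp only [z', dif_neg h]
  have hq'0 : ∀ y, (¬ ∃ i, t' i = y) → q' y = e y := fun y h => by simp only [q', dif_neg h]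
  have hcover' : ∀ y, z' y ≠ 0 → ∃ i, t' i = y := fun y h => by
    by_contra hn
    exact h (hz'0 y hn)
  have hlt : ∀ i j, levelLT z q (t i) (t j) ↔ levelLT z' q' (t' i) (t' j) := by
    intro i j
    simp only [levelLT, hz't, hq't]
  have hr : IsStrictTotalOrder M (levelLT z q) :=
    levelLT_isStrictTotalOrder fun x y _ h => hq h
  have hr' : IsStrictTotalOrder N (levelLT z' q') := by
    refine levelLT_isStrictTotalOrder fun x y h1 h2 => ?_
    by_cases hx : ∃ i, t' i = x
    · obtain ⟨i, rfl⟩ := hx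
      obtain ⟨j, rfl⟩ := hcover' y (by rw [← h1, hz't]; exact hne i)
      rw [hq't, hq't] at h2
      exact (hteq _ _).1 (hq h2)
    · by_cases hy : ∃ i, t' i = y
      · obtain ⟨j, rfl⟩ := hy
        rw [hz't, hz'0 x hx] at h1
        exact absurd h1.symm (hne j)
      · rw [hq'0 x hx, hq'0 y hy] at h2
        exact e.injective (Fin.ext h2)
  have hlip' : ∀ x y, Linked L x y → (z' x - z' y).natAbs ≤ 1 := by
    -- A link may leave the copy only at levels `±1`, where dropping to `0` is allowed.
    have key : ∀ i y, Linked L (t' i) y → (z' (t' i) - z' y).natAbs ≤ 1 := by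
      intro i y h
      have hy : (∃ j, t' j = y) ∨ ((z (t i)).natAbs < 2 ∧ ¬ ∃ j, t' j = y) := by
        by_cases h2 : 2 ≤ (z (t i)).natAbs
        · exact Or.inl (hfit.closed i h2 y h)
        · by_cases h3 : ∃ j, t' j = y
          · exact Or.inl h3
          · exact Or.inr ⟨by omega, h3⟩
      rcases hy with ⟨j, rfl⟩ | ⟨h2, hy⟩
      · rw [hz't, hz't]
        exact hz _ _ ((linked_iff_of_color (hcol i j)).2 h)
      · rw [hz't, hz'0 y hy]
        omega
    intro x y h
    by_cases hx : ∃ i, t' i = x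
    · obtain ⟨i, rfl⟩ := hx
      exact key i y h
    · by_cases hy : ∃ i, t' i = y
      · obtain ⟨i, rfl⟩ := hy
        have := key i x h.symm
        omega
      · rw [hz'0 x hx, hz'0 y hy]
        decide
  have hcov' : ∀ y, z' y = -Z ∨ ∃ τ ∈ T, ∃ u, u 0 = y ∧ HasType u τ := by
    intro y
    rcases hfit.cover y with ⟨i, hi, rfl⟩ | h
    · exact Or.inl (by rw [hz't]; exact hi)
    · exact Or.inr h
  have hsup' : Supplies L Z z' (levelLT z' q') T := by
    intro τ hτ p hp l hl hlK s hs
    obtain ⟨w, hw, hwz, hwp⟩ := hsup τ hτ p hp l hl hlK s hs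
    have h2 : ∀ i, 2 ≤ (z (w i)).natAbs := by
      intro i
      rw [hwz]
      rcases hs with rfl | rfl <;> omega
    choose κ hκ using fun i => (ht (w i)).1 (by have := h2 i; omega)
    refine ⟨fun i => t' (κ i), ⟨fun i j => ?_, fun i hi y hy => ?_, hw.center⟩, fun i => ?_,
      fun i j => ?_⟩
    · rw [← hcol, hκ, hκ, hw.color_eq]
    · obtain ⟨j, rfl⟩ := hfit.closed (κ i) (by simpa [hκ] using h2 i) y hy
      obtain ⟨i', hi', hfuel⟩ := hw.insulated i hi (t j)
        (by rw [← hκ]; exact (linked_iff_of_color (hcol _ _)).2 hy)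
      exact ⟨i', (hteq _ _).1 (by rw [hκ, hi']), hfuel⟩
    · rw [hz't, hκ, hwz]
    · rw [hwp, ← hlt, hκ, hκ]
  have hcn : ∀ c : L.Constants, z' (c : N) = -Z := by
    intro c
    have h := hc c
    obtain ⟨i, hi⟩ := (ht (c : M)).1 (by omega)
    rw [← (eq_const_iff_of_color (hcol i i) c).1 hi, hz't, hi, h]
  refine ⟨z', levelLT z' q', hr', ⟨hcol, hlt, fun i => (hz't i).symm, fun x => (ht x).1, hz,
    fun x y h => Or.inl h, ?_, ?_, hc, exists_localSim_of_supplies hr hcov hsup'⟩,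
    ⟨fun i j => (hcol i j).symm, fun i j => (hlt i j).symm, hz't, hcover', hlip',
    fun x y h => Or.inl h, ?_, ?_, hcn, exists_localSim_of_supplies hr' hcov' hsup⟩⟩
  · exact fun x y h h' => hr.irrefl _ (hr.trans _ _ _ h h')
  · intro x y h
    by_contra! h'
    exact h (hr.trichotomous _ _ h'.1 h'.2)
  · exact fun x y h h' => hr'.irrefl _ (hr'.trans _ _ _ h h')
  · intro x y h
    by_contra! h'
    exact h (hr'.trichotomous _ _ h'.1 h'.2)

end Copy

/-! ### First-order definability -/

section Definability

variable {L : FirstOrder.Language.{u, v}} {α : Type}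

/-- A property of tuples in finite structures that is defined by a first-order formula. -/
def FODefinable (Q : ∀ A : FinStr.{u, v, w} L, (α → A.Carrier) → Prop) : Prop :=
  ∃ φ : L.Formula α, ∀ (A : FinStr.{u, v, w} L) (x : α → A.Carrier), φ.Realize x ↔ Q A x

namespace FODefinable

variable {P Q : ∀ A : FinStr.{u, v, w} L, (α → A.Carrier) → Prop}

theorem congr (hP : FODefinable P) (h : ∀ A x, P A x ↔ Q A x) : FODefinable Q := by
  obtain ⟨φ, hφ⟩ := hP
  exact ⟨φ, fun A x => (hφ A x).trans (h A x)⟩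

theorem not (hP : FODefinable P) : FODefinable fun A x => ¬ P A x := by
  obtain ⟨φ, hφ⟩ := hP
  exact ⟨φ.not, fun A x => by rw [Formula.realize_not, hφ]⟩

theorem forall_finite {β : Type*} [Finite β]
    {P : β → ∀ A : FinStr.{u, v, w} L, (α → A.Carrier) → Prop} (hP : ∀ b, FODefinable (P b)) :
    FODefinable fun A x => ∀ b, P b A x := by
  choose φ hφ using hP
  exact ⟨BoundedFormula.iInf φ, fun A x => by
    rw [Formula.Realize, BoundedFormula.realize_iInf]
    exact forall_congr' fun b => hφ b A x⟩

theorem exists_finite {β : Type*} [Finite β]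
    {P : β → ∀ A : FinStr.{u, v, w} L, (α → A.Carrier) → Prop} (hP : ∀ b, FODefinable (P b)) :
    FODefinable fun A x => ∃ b, P b A x := by
  choose φ hφ using hP
  exact ⟨BoundedFormula.iSup φ, fun A x => by
    rw [Formula.Realize, BoundedFormula.realize_iSup]
    exact exists_congr fun b => hφ b A x⟩

theorem const (p : Prop) : FODefinable fun (A : FinStr.{u, v, w} L) (_ : α → A.Carrier) => p := by
  by_cases hp : p
  · exact ⟨⊤, fun A x => by simp [hp]⟩
  · exact ⟨⊥, fun A x => by simp [hp]⟩

theorem and (hP : FODefinable P) (hQ : FODefinable Q) : FODefinable fun A x => P A x ∧ Q A x := by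
  obtain ⟨φ, hφ⟩ := hP
  obtain ⟨ψ, hψ⟩ := hQ
  exact ⟨φ ⊓ ψ, fun A x => by rw [Formula.realize_inf, hφ, hψ]⟩

theorem or (hP : FODefinable P) (hQ : FODefinable Q) : FODefinable fun A x => P A x ∨ Q A x := by
  obtain ⟨φ, hφ⟩ := hP
  obtain ⟨ψ, hψ⟩ := hQ
  exact ⟨φ ⊔ ψ, fun A x => by rw [Formula.realize_sup, hφ, hψ]⟩

theorem imp (hP : FODefinable P) (hQ : FODefinable Q) : FODefinable fun A x => P A x → Q A x := by
  obtain ⟨φ, hφ⟩ := hP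
  obtain ⟨ψ, hψ⟩ := hQ
  exact ⟨φ.imp ψ, fun A x => by rw [Formula.realize_imp, hφ, hψ]⟩

theorem iff (hP : FODefinable P) (hQ : FODefinable Q) : FODefinable fun A x => P A x ↔ Q A x := by
  obtain ⟨φ, hφ⟩ := hP
  obtain ⟨ψ, hψ⟩ := hQ
  exact ⟨φ.iff ψ, fun A x => by rw [Formula.realize_iff, hφ, hψ]⟩

theorem exists_tuple {β : Type} [Finite β]
    {P : ∀ A : FinStr.{u, v, w} L, (α ⊕ β → A.Carrier) → Prop} (hP : FODefinable P) :
    FODefinable fun A (x : α → A.Carrier) => ∃ y : β → A.Carrier, P A (Sum.elim x y) := by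
  obtain ⟨φ, hφ⟩ := hP
  exact ⟨Formula.iExs β φ, fun A x => by
    rw [Formula.realize_iExs]
    exact exists_congr fun y => hφ A _⟩

theorem forall_elem {P : ∀ A : FinStr.{u, v, w} L, (α ⊕ Unit → A.Carrier) → Prop}
    (hP : FODefinable P) :
    FODefinable fun A (x : α → A.Carrier) => ∀ y : A.Carrier, P A (Sum.elim x fun _ => y) := by
  refine hP.not.exists_tuple.not.congr fun A x => ?_
  simp only [not_exists, not_not]
  exact ⟨fun h y => h _, fun h y => h (y ())⟩

/-- A colour is a finite conjunction of literals, and a property of colours is a finite disjunction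
over the colours that have it. -/
theorem color_prop [Finite (Color L)] [Finite L.Constants] [Finite (Σ n, L.Relations n)]
    (X : Color L → Prop) (a b : α) :
    FODefinable fun (_ : FinStr.{u, v, w} L) x => X (color L (x a) (x b)) := by
  have hterm : ∃ g : PairTerm L → L.Term α, ∀ i (A : FinStr.{u, v, w} L) (x : α → A.Carrier),
      (g i).realize x = pairEval L (x a) (x b) i := by
    refine ⟨Sum.elim (fun i => Term.var (![a, b] i)) fun c => c.term, ?_⟩
    rintro (i | c) A x
    · fin_cases i <;> rfl
    · exact Term.realize_constants
  obtain ⟨g, hg⟩ := hterm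
  have hcol : ∀ c : Color L,
      FODefinable fun (A : FinStr.{u, v, w} L) x => color L (x a) (x b) = c := by
    intro c
    refine congr (P := fun A x => (∀ i j, (color L (x a) (x b)).1 i j ↔ c.1 i j) ∧
      ∀ R ts, (color L (x a) (x b)).2 R ts ↔ c.2 R ts) ?_ ?_
    · refine and (forall_finite fun i => forall_finite fun j => iff ?_ (const _))
        (forall_finite fun R => forall_finite fun ts => iff ?_ (const _))
      · exact ⟨(g i).equal (g j), fun A x => by rw [Formula.realize_equal, hg, hg]; rfl⟩
      · exact ⟨R.2.formula fun k => g (ts k), fun A x => by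
          simp only [Formula.realize_rel, hg]; rfl⟩
    · intro A x
      refine ⟨fun h => Prod.ext ?_ ?_, fun h => by simp [h]⟩
      · exact funext fun i => funext fun j => propext (h.1 i j)
      · exact funext fun R => funext fun ts => propext (h.2 R ts)
  refine (exists_finite fun c : {c // X c} => hcol c).congr fun A x => ?_
  exact ⟨fun ⟨c, hc⟩ => hc ▸ c.2, fun h => ⟨⟨_, h⟩, rfl⟩⟩

section

variable [Finite (Color L)] [Finite L.Constants] [Finite (Σ n, L.Relations n)]

theorem linked (a b : α) :
    FODefinable fun (_ : FinStr.{u, v, w} L) x => Linked L (x a) (x b) :=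
  color_prop Color.IsLink a b

theorem eq (a b : α) : FODefinable fun (_ : FinStr.{u, v, w} L) x => x a = x b :=
  color_prop (fun c => c.1 (Sum.inl 0) (Sum.inl 1)) a b

theorem insulated {ι : Type} [Finite ι] (f : ι → α) (h : ι → ℕ) :
    FODefinable fun (_ : FinStr.{u, v, w} L) x => Insulated L (fun i => x (f i)) h := by
  refine forall_finite fun i => imp (const _) ?_
  exact forall_elem (P := fun A x => Linked L (x (Sum.inl (f i))) (x (Sum.inr ())) →
    ∃ j, x (Sum.inl (f j)) = x (Sum.inr ()) ∧ h i ≤ h j + 1)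
    (imp (linked _ _) (exists_finite fun j => and (eq _ _) (const _)))

theorem hasType {m K : ℕ} (f : Fin (m + 1) → α) (τ : LocalType L m K) :
    FODefinable fun (_ : FinStr.{u, v, w} L) x => HasType (fun i => x (f i)) τ := by
  refine congr (P := fun A x => (∀ i j, color L (x (f i)) (x (f j)) = τ.1 i j) ∧
    Insulated L (fun i => x (f i)) (fun i => τ.2 i) ∧ (τ.2 0 : ℕ) = K) ?_
    fun A x => ⟨fun h => ⟨h.1, h.2.1, h.2.2⟩, fun h => ⟨h.1, h.2, h.3⟩⟩
  exact and (forall_finite fun i => forall_finite fun j => color_prop (· = τ.1 i j) _ _)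
    (and (insulated f _) (const _))

theorem fits {k m K : ℕ} (f : Fin k → α) (D : Fin k → Fin k → Color L)
    (core inner : Set (Fin k)) (T : Set (LocalType L m K)) :
    FODefinable fun (_ : FinStr.{u, v, w} L) x => Fits D core inner T fun i => x (f i) := by
  refine congr (P := fun A x => (∀ i j, color L (x (f i)) (x (f j)) = D i j) ∧
    (∀ i : Fin k, i ∈ inner → ∀ y, Linked L (x (f i)) y → ∃ j, x (f j) = y) ∧
    ∀ y, (∃ i : Fin k, i ∈ core ∧ x (f i) = y) ∨ ∃ τ : LocalType L m K, τ ∈ T ∧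
      ∃ u : Fin (m + 1) → A.Carrier, u 0 = y ∧ HasType u τ) ?_
    fun A x => ⟨fun h => ⟨h.1, h.2.1, h.2.2⟩, fun h => ⟨h.1, h.2, h.3⟩⟩
  refine and (forall_finite fun i => forall_finite fun j => color_prop (· = D i j) _ _)
    (and (forall_finite fun i => imp (const _) ?_) ?_)
  · exact forall_elem (P := fun A x => Linked L (x (Sum.inl (f i))) (x (Sum.inr ())) →
      ∃ j, x (Sum.inl (f j)) = x (Sum.inr ())) (imp (linked _ _) (exists_finite fun j => eq _ _))
  · refine forall_elem (P := fun A x =>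
      (∃ i : Fin k, i ∈ core ∧ x (Sum.inl (f i)) = x (Sum.inr ())) ∨
      ∃ τ : LocalType L m K, τ ∈ T ∧
        ∃ u : Fin (m + 1) → A.Carrier, u 0 = x (Sum.inr ()) ∧ HasType u τ)
      (or (exists_finite fun i => and (const _) (eq _ _))
        (exists_finite fun τ => and (const _) ?_))
    exact exists_tuple (P := fun A x => x (Sum.inr 0) = x (Sum.inl (Sum.inr ())) ∧
      HasType (fun i => x (Sum.inr i)) τ) (and (eq _ _) (hasType _ _))

end

end FODefinable

end Definability

/-! ### The main theorem -/

section Main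

variable {L : FirstOrder.Language.{u, v}}

variable (L) in
/-- The data of which the first-order sentences speak that separate the structures. -/
abbrev Template (m K b : ℕ) :=
  Σ k : Fin (b + 1), (Fin k → Fin k → Color L) × Set (Fin k) × Set (Fin k) ×
    Set (LocalType L m K)

/-- Some tuple of the structure fits the template. -/
def Template.Holds {m K b : ℕ} (σ : Template L m K b) (A : FinStr.{u, v, w} L) : Prop :=
  ∃ t : Fin σ.1 → A.Carrier, Fits σ.2.1 σ.2.2.1 σ.2.2.2.1 σ.2.2.2.2 t

/-- Each structure of bounded degree satisfies a template that forces the truth of a given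
order-invariant sentence of the structure. -/
theorem exists_template (hL : IsFiniteSignature L) (φ : Formula2 (L.sum ltLang))
    (hφ : OrderInvariant.{u, v, w} φ) (d : ℕ) :
    ∃ m K b : ℕ, ∀ A : FinStr.{u, v, w} L, DegreeLE A d →
      (∀ r, IsStrictTotalOrder A.Carrier r → φ.Models (A.expand r)) →
      ∃ σ : Template L m K b, σ.Holds A ∧ ∀ B : FinStr.{u, v, w} L, σ.Holds B →
        ∀ r, IsStrictTotalOrder B.Carrier r → φ.Models (B.expand r) := by
  -- Two rounds place the pebbles. The choice of `Z` keeps all copied elements and all replies far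
  -- from level `0`, leaving enough fuel for the rounds that remain.
  let K := φ.rank + 2
  let Z := 2 * K + 3
  obtain ⟨b, hb⟩ := exists_layout.{u, v, w} hL d K Z (by omega)
  refine ⟨(d + 1) ^ K, K, b, fun A hA hmod => ?_⟩
  obtain ⟨z, q, T, hq, hz, hc, hzb, hcov, hsup⟩ := hb A hA
  let e := Finite.equivFin {x | z x ≠ 0}
  have ht : ∀ x, z x ≠ 0 ↔ ∃ i, (e.symm i : A.Carrier) = x := by
    intro x
    constructor
    · intro hx
      exact ⟨e ⟨x, hx⟩, congrArg Subtype.val (e.symm_apply_apply _)⟩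
    · rintro ⟨i, rfl⟩
      exact (e.symm i).2
  let t : Fin (Nat.card {x | z x ≠ 0}) → A.Carrier := fun i => e.symm i
  refine ⟨⟨⟨Nat.card {x | z x ≠ 0}, Nat.lt_succ_of_le hzb⟩, fun i j => color L (t i) (t j),
    {i | z (t i) = -Z}, {i | 2 ≤ (z (t i)).natAbs}, T⟩, ⟨t, fun _ _ => rfl, ?_, ?_⟩, ?_⟩
  · intro i hi y hy
    have h1 := hz _ _ hy
    have h2 : 2 ≤ (z (t i)).natAbs := hi
    exact (ht y).1 (by omega)
  · intro y
    rcases hcov y with h | h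
    · obtain ⟨i, rfl⟩ := (ht y).1 (by omega)
      exact Or.inl ⟨i, h, rfl⟩
    · exact Or.inr h
  · rintro B ⟨t', ht'⟩ r hr
    obtain ⟨z', r', hr', H, H'⟩ := exists_matched le_rfl hq hz hc hcov hsup ht ht'
    -- The game compares only the two constructed orders; order-invariance then passes to an
    -- arbitrary order on `B`.
    refine (hφ B r' r hr' hr).1 (H.models_of_models hL H' le_rfl le_rfl (hmod _ ?_))
    exact levelLT_isStrictTotalOrder fun x y _ h => hq h

theorem Template.exists_sentence (hL : IsFiniteSignature L) {m K b : ℕ}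
    (S : Set (Template L m K b)) :
    ∃ ψ : L.Sentence, ∀ A : FinStr.{u, v, w} L, A.Carrier ⊨ ψ ↔ ∃ σ ∈ S, σ.Holds A := by
  have := finite_color hL
  have := finite_constants hL
  have := finite_relations hL
  obtain ⟨ψ, hψ⟩ : FODefinable fun (A : FinStr.{u, v, w} L) (_ : Empty → A.Carrier) =>
      ∃ σ : Template L m K b, σ ∈ S ∧ σ.Holds A := by
    refine .exists_finite fun σ => .and (.const _) ?_
    exact FODefinable.exists_tuple (P := fun A x =>
      Fits σ.2.1 σ.2.2.1 σ.2.2.2.1 σ.2.2.2.2 fun i => x (Sum.inr i)) (.fits _ _ _ _ _)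
  exact ⟨ψ, fun A => hψ A default⟩

end Main

end TwoVarOrder

theorem theorem1 (L : FirstOrder.Language.{u, v}) (hL : TwoVarOrder.IsFiniteSignature L)
    (C : Set (TwoVarOrder.FinStr.{u, v, w} L)) (hC : TwoVarOrder.BoundedDegree C) :
    TwoVarOrder.LogicSubsetOn C (TwoVarOrder.OrderInvFO2 L) (TwoVarOrder.FO L) := by
  obtain ⟨d, hd⟩ := hC
  rintro P - ⟨⟨φ, -, hφ⟩, rfl⟩
  obtain ⟨m, K, b, h⟩ := TwoVarOrder.exists_template hL φ hφ d
  -- The disjuncts are selected by what they force in all finite structures, so soundness is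
  -- immediate; completeness on `C` is `exists_template`.
  obtain ⟨ψ, hψ⟩ := TwoVarOrder.Template.exists_sentence.{u, v, w} hL
    {σ : TwoVarOrder.Template L m K b | ∀ B : TwoVarOrder.FinStr.{u, v, w} L, σ.Holds B →
      ∀ r, IsStrictTotalOrder B.Carrier r → φ.Models (B.expand r)}
  refine ⟨ψ, Set.ext fun A => and_congr_right fun hA => ?_⟩
  refine Iff.trans ?_ (hψ A).symm
  constructor
  · intro hmod
    obtain ⟨σ, hσA, hσ⟩ := h A (hd A hA) hmod
    exact ⟨σ, hσ, hσA⟩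
  · rintro ⟨σ, hσ, hσA⟩
    exact hσ A hσA
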